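/- Let $n\ge 0$ and let $E$ be either $\mathscr D=\mathscr D(\mathbb R^n)$, the space of complex-valued $C^\infty$ functions with compact support with its (LF) topology, or $\mathscr S=\mathscr S(\mathbb R^n)$, the Schwartz space with its Fréchet topology; let $E'$ be the space of continuous linear functionals on $E$. Definitions. $C(0)$ is the set of functions $\gamma:\mathbb C\to\mathbb C$ with $\lim_{t\to0}\gamma(t)=\gamma(0)=0$ and $|\gamma(t)|\ge|t|$ whenever $|t|\le1$. For $\gamma\in C(0)$ and a neighbourhood $U$ of $0$ in $E$, $E^{(\gamma,U)}$ is the set of continuous functions $g:E\to\mathbb C$ with $g(0)=0$ such that for all $\xi\in E$, $\eta\in U$ and $t\in\mathbb C$ with $|t|\le1$ there are $r,s\in\mathbb C$ with $|r-1|\le|\gamma(t)|$, $|s|\le|\gamma(t)|$ and $g(\xi+t\eta)=r\,g(\xi)+s\,g(\eta)$; $[E^{(\gamma,U)}]$ is its linear span in $\mathbb C^E$. The support of $f\in E'$ is the complement of the union of all open $G\subset\mathbb R^n$ such that $f(\xi)=0$ for every $\xi\in E$ with $\operatorname{supp}\xi\subset G$. For $f_0\in E'$ and $\xi\in E$ put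 $(f_0*\xi)(x)=f_0(\xi(x+\cdot))$, $x\in\mathbb R^n$; $f_0$ is a convolution multiplier on $E$ if $f_0*\xi\in E$ for all $\xi\in E$ and $f_0*\xi_k\to0$ in $E$ whenever $\xi_k\to0$ in $E$. For a convolution multiplier $f_0$ and $g\in[E^{(\gamma,U)}]$ put $(f_0*g)(\xi)=g(f_0*\xi)$, $\xi\in E$. Theorem 4.4. Let $(f_k)_{k\in\mathbb N}$ be a sequence in $E'$ and $f:E\to\mathbb C$ a function such that $f_k(\xi)\to f(\xi)$ for every $\xi\in E$, and suppose that there is a bounded set $F\subset\mathbb R^n$ with $\operatorname{supp}f_k\subset F$ for all $k$. Then $f\in E'$, all $f_k$ and $f$ are convolution multipliers on $E$, and for all $\gamma\in C(0)$, all neighbourhoods $U$ of $0$ in $E$, all $g\in[E^{(\gamma,U)}]$ and all bounded $B\subset E$, $$\lim_{k\to\infty}(f_k*g)(\xi)=(f*g)(\xi)\quad\text{uniformly for }\xi\in B.$$ -/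

import Mathlib

open Filter Topology TopologicalSpace Bornology Distribution
open scoped Distributions SchwartzMap

/-- The space `𝓓(ℝⁿ)` of compactly supported smooth functions `ℝⁿ → ℂ`, with its (LF) topology. -/
abbrev TestD (n : ℕ) : Type := 𝓓((⊤ : Opens (EuclideanSpace ℝ (Fin n))), ℂ)

/-- The space `𝓢(ℝⁿ)` of rapidly decreasing smooth functions `ℝⁿ → ℂ`, with its Fréchet topology. -/
abbrev TestS (n : ℕ) : Type := 𝓢(EuclideanSpace ℝ (Fin n), ℂ)

/-- A space `E` of functions on `X` that contains `ξ(x + ·)` along with each `ξ`. It is used only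
for the two instances `TestD n` and `TestS n` below. -/
class TranslationInvariant (E : Type*) {X : outParam (Type*)} [Add X] [FunLike E X ℂ] where
  /-- `translate x ξ = ξ(x + ·)` -/
  translate : X → E → E
  translate_apply : ∀ (x : X) (ξ : E) (y : X), translate x ξ y = ξ (x + y)

noncomputable instance instTranslationInvariantTestD (n : ℕ) : TranslationInvariant (TestD n) where
  translate x ξ :=
    { toFun := fun y => ξ (x + y)
      contDiff' := ξ.contDiff.comp (contDiff_const.add contDiff_id)
      hasCompactSupport' := ξ.hasCompactSupport.comp_homeomorph (Homeomorph.addLeft x)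
      tsupport_subset' := fun _ _ => trivial }
  translate_apply _ _ _ := rfl

noncomputable instance instTranslationInvariantTestS (n : ℕ) : TranslationInvariant (TestS n) where
  translate x ξ := SchwartzMap.compSubConstCLM ℂ (-x) ξ
  translate_apply x ξ y := by
    rw [SchwartzMap.compSubConstCLM_apply, sub_neg_eq_add, add_comm]

/-- The family `C(0)` of functions `γ : ℂ → ℂ` with `γ(t) → γ(0) = 0` as `t → 0` and
`|γ(t)| ≥ |t|` for `|t| ≤ 1`. -/
def CZero : Set (ℂ → ℂ) :=
  {γ | γ 0 = 0 ∧ Tendsto γ (𝓝 0) (𝓝 0) ∧ ∀ t : ℂ, ‖t‖ ≤ 1 → ‖t‖ ≤ ‖γ t‖}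

section Generic

variable {E : Type*} [AddCommGroup E] [Module ℂ E] [TopologicalSpace E]

/-- The class `ℒ_{γ,U}(E, ℂ)` of demi-linear functionals. -/
def IsDemiLinear (γ : ℂ → ℂ) (U : Set E) (g : E → ℂ) : Prop :=
  g 0 = 0 ∧ ∀ ξ : E, ∀ η ∈ U, ∀ t : ℂ, ‖t‖ ≤ 1 →
    ∃ r s : ℂ, ‖r - 1‖ ≤ ‖γ t‖ ∧ ‖s‖ ≤ ‖γ t‖ ∧ g (ξ + t • η) = r * g ξ + s * g η

/-- The family `E^{(γ,U)}` of demi-distributions related to `γ` and `U`. -/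
def demiDistributions (γ : ℂ → ℂ) (U : Set E) : Set (E → ℂ) :=
  {g | Continuous g ∧ IsDemiLinear γ U g}

/-- The linear span `[E^{(γ,U)}]` of `E^{(γ,U)}` in `ℂ^E`. -/
noncomputable def demiSpan (γ : ℂ → ℂ) (U : Set E) : Submodule ℂ (E → ℂ) :=
  Submodule.span ℂ (demiDistributions γ U)

variable {X : Type*} [Add X] [FunLike E X ℂ] [TranslationInvariant E]

/-- The function `(f₀ ∗ ξ)(x) = f₀(ξ(x + ·))` on `X`. -/
noncomputable def convFun (f₀ : E →L[ℂ] ℂ) (ξ : E) : X → ℂ :=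
  fun x => f₀ (TranslationInvariant.translate x ξ)

/-- `f₀` is a convolution multiplier on `E`: (i) `f₀ ∗ ξ ∈ E` for every `ξ ∈ E`, and
(ii) `f₀ ∗ ξ_k → 0` in `E` whenever `ξ_k → 0` in `E`. -/
structure IsConvolutionMultiplier (f₀ : E →L[ℂ] ℂ) : Prop where
  mem : ∀ ξ : E, ∃ η : E, ⇑η = convFun f₀ ξ
  tendsto_zero : ∀ ξ η : ℕ → E, (∀ k, ⇑(η k) = convFun f₀ (ξ k)) →
    Tendsto ξ atTop (𝓝 0) → Tendsto η atTop (𝓝 0)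

/-- `f₀ ∗ ξ` as an element of `E` (unique, since elements of `E` are functions). -/
noncomputable def IsConvolutionMultiplier.conv {f₀ : E →L[ℂ] ℂ}
    (h : IsConvolutionMultiplier f₀) (ξ : E) : E :=
  (h.mem ξ).choose

/-- The convolution `(f₀ ∗ g)(ξ) = g(f₀ ∗ ξ)` of a convolution multiplier `f₀` with a functional
`g` on `E`. -/
noncomputable def IsConvolutionMultiplier.convFunctional {f₀ : E →L[ℂ] ℂ}
    (h : IsConvolutionMultiplier f₀) (g : E → ℂ) : E → ℂ :=
  fun ξ => g (h.conv ξ)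

end Generic

/-! Choose a smooth cutoff `χ`, supported in a compact `K` and equal to 1 on a ball around `F`. A
functional with support in `F` kills `ξ - χξ`, so `f_k(ξ) = L_k(χξ)` with `L_k` the restriction of
`f_k` to `𝓓_K`, and everything reduces to functionals on `𝓓_K`. (On `𝓓` the vanishing follows from a
partition of unity; on `𝓢` one first approximates by test functions.)

The space `𝓓_K` is Fréchet, hence Baire, so Banach–Steinhaus makes `(L_k)` equicontinuous and the
pointwise limit `L₀` continuous. By Arzelà–Ascoli, a set of `φ` with every derivative bounded is
totally bounded. Hence `L_k → L₀` uniformly on such sets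
(`ContDiffMapSupportedIn.exists_limit_uniform_of_tendsto`).

Each `L_k` has finite order, so `Λ_k = L_k(χ ·)` acts on all smooth functions, and `x ↦ Λ_k(h(x +
·))` is smooth with derivatives `Λ_k(∂h(x + ·))`. This gives continuous convolution operators `T_k`
and `T₀` on `E`. For `ξ` in a bounded set the translates of `∂ξ`, weighted by a power of `1 + |x|`
in the case of `𝓢`, have derivatives bounded on `K` uniformly in `x` and `ξ`. The uniform
convergence above therefore yields `T_k ξ → T₀ ξ` uniformly on bounded sets.

Finally, if `T_k ξ = T₀ ξ + tη` with `η` small, demi-linearity gives `|g(T_k ξ) - g(T₀ ξ)| ≤ |γ(t)|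
(|g(T₀ ξ)| + |g(η)|)`. Since `g` is bounded on bounded sets and `γ(t) → 0`, the right side is
uniformly small (`IsDemiLinear.tendstoUniformlyOn`). The span follows by linearity. -/

open scoped ContDiff

/-! ### Completeness and the Baire property of `𝓓_K` -/

namespace ContDiffMapSupportedIn

open BoundedContinuousFunction

variable {X F : Type*} [NormedAddCommGroup X] [NormedSpace ℝ X]
  [NormedAddCommGroup F] [NormedSpace ℝ F] {K : Compacts X}

theorem tendsto_iff_structureMapCLM {ι : Type*} {l : Filter ι} {u : ι → 𝓓_{K}(X, F)}
    {φ : 𝓓_{K}(X, F)} :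
    Tendsto u l (𝓝 φ) ↔
      ∀ i, Tendsto (fun k => structureMapCLM ℝ ⊤ i (u k)) l (𝓝 (structureMapCLM ℝ ⊤ i φ)) := by
  rw [(isUniformEmbedding_pi_structureMapCLM (𝕜 := ℝ)).isEmbedding.tendsto_nhds_iff,
    tendsto_pi_nhds]
  rfl

theorem cauchy_iff_structureMapCLM {l : Filter 𝓓_{K}(X, F)} :
    Cauchy l ↔ ∀ i, Cauchy (l.map (structureMapCLM ℝ ⊤ i)) := by
  have h := ContDiffMapSupportedIn.uniformSpace_eq_iInf (E := X) (F := F) (n := ⊤) (K := K)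
  rw [h, cauchy_iInf_uniformSpace]
  simp_rw [cauchy_comap_uniformSpace]
  rfl

instance : (uniformity 𝓓_{K}(X, F)).IsCountablyGenerated :=
  haveI := (ContDiffMapSupportedIn.withSeminorms ℝ X F ⊤ K).firstCountableTopology
  IsUniformAddGroup.uniformity_countably_generated

/-- Uniform convergence of the derivatives lets differentiation pass to the limit, so the limits `g
i` form a Taylor series of `g 0`. Vanishing off `K` survives pointwise limits. -/
theorem exists_tendsto_of_structureMapCLM {u : ℕ → 𝓓_{K}(X, F)}
    {g : ∀ i : ℕ, X →ᵇ (X [×i]→L[ℝ] F)}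
    (hg : ∀ i, Tendsto (fun k => structureMapCLM ℝ ⊤ i (u k)) atTop (𝓝 (g i))) :
    ∃ φ, Tendsto u atTop (𝓝 φ) := by
  have hu (i : ℕ) : TendstoUniformly (fun k x => iteratedFDeriv ℝ i (u k) x) (g i) atTop := by
    have := tendsto_iff_tendstoUniformly.1 (hg i)
    simpa only [structureMapCLM_top_apply] using this
  have hpt (i : ℕ) (x : X) :
      Tendsto (fun k => iteratedFDeriv ℝ i (u k) x) atTop (𝓝 (g i x)) := (hu i).tendsto_at x
  have hT : HasFTaylorSeriesUpTo (⊤ : ℕ∞) (fun x => (g 0 x).curry0) (fun x i => g i x) := by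
    refine ⟨fun x => rfl, fun m _ x => ?_, fun m _ => (g m).continuous⟩
    let c := continuousMultilinearCurryLeftEquiv ℝ (fun _ : Fin (m + 1) => X) F
    refine hasFDerivAt_of_tendstoUniformly (l := atTop)
      (f := fun k y => iteratedFDeriv ℝ m (u k) y)
      (f' := fun k y => (iteratedFDeriv ℝ (m + 1) (u k) y).curryLeft)
      (g' := fun y => (g (m + 1) y).curryLeft) ?_ (fun k y => ?_) (fun y => hpt m y) x
    · exact c.isometry.uniformContinuous.comp_tendstoUniformly (hu (m + 1))
    · exact ((u k).contDiff.ftaylorSeries).fderiv m (by exact_mod_cast WithTop.coe_lt_top m) y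
  have hsupp : Set.EqOn (fun x => (g 0 x).curry0) 0 (K : Set X)ᶜ := by
    intro x hx
    have h0 : g 0 x = 0 := by
      refine tendsto_nhds_unique (hpt 0 x) ?_
      simp [(u _).iteratedFDeriv_zero_on_compl hx]
    simp [h0]
  refine ⟨⟨_, hT.contDiff, hsupp⟩, tendsto_iff_structureMapCLM.2 fun i => ?_⟩
  convert hg i using 2
  ext x : 1
  rw [structureMapCLM_top_apply]
  exact (hT.eq_iteratedFDeriv (by exact_mod_cast le_top) x).symm

instance [CompleteSpace F] : CompleteSpace 𝓓_{K}(X, F) := by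
  refine UniformSpace.complete_of_cauchySeq_tendsto fun u hu => ?_
  have h (i : ℕ) : ∃ g, Tendsto (fun k => structureMapCLM ℝ ⊤ i (u k)) atTop (𝓝 g) :=
    cauchySeq_tendsto_of_complete (cauchy_iff_structureMapCLM.1 hu i)
  choose g hg using h
  exact exists_tendsto_of_structureMapCLM hg

/-- The uniformity is complete and countably generated, so Baire's theorem for complete pseudometric
spaces applies. Banach–Steinhaus on `𝓓_K` relies on this. -/
instance [CompleteSpace F] : BaireSpace 𝓓_{K}(X, F) := by
  let := UniformSpace.pseudoMetricSpace 𝓓_{K}(X, F)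
  infer_instance

end ContDiffMapSupportedIn

/-! ### Arzelà–Ascoli and the Montel property of `𝓓_K` -/

/-- Restriction to `K` is isometric on functions vanishing off `K`, which moves the question to a
compact domain. There Arzelà–Ascoli applies, closed balls of `G` being compact. -/
theorem BoundedContinuousFunction.totallyBounded_of_lipschitz_of_support {X G : Type*}
    [PseudoMetricSpace X] [NormedAddCommGroup G] [NormedSpace ℝ G] [FiniteDimensional ℝ G]
    {K : Set X} (hK : IsCompact K) {A : Set (BoundedContinuousFunction X G)} {M : ℝ} {C : NNReal}
    (hb : ∀ f ∈ A, ‖f‖ ≤ M) (hL : ∀ f ∈ A, LipschitzWith C f)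
    (h0 : ∀ f ∈ A, ∀ x ∉ K, f x = 0) : TotallyBounded A := by
  have : CompactSpace K := isCompact_iff_compactSpace.1 hK
  have : ProperSpace G := FiniteDimensional.proper_real G
  let r : A → BoundedContinuousFunction K G := fun f => f.1.domRestrict K
  have hr : Isometry r := by
    refine Isometry.of_dist_eq fun f g => le_antisymm ?_ ?_
    · refine (dist_le dist_nonneg).2 fun x => ?_
      exact dist_coe_le_dist (f := f.1) (g := g.1) x.1
    · refine (dist_le dist_nonneg).2 fun x => ?_
      by_cases hx : x ∈ K
      · exact dist_coe_le_dist (f := r f) (g := r g) ⟨x, hx⟩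
      · simp [h0 f.1 f.2 x hx, h0 g.1 g.2 x hx]
  have hc : IsCompact (closure (Set.range r)) := by
    refine arzela_ascoli _ (isCompact_closedBall (0 : G) M) _ ?_ ?_
    · rintro _ x ⟨f, rfl⟩
      exact mem_closedBall_zero_iff.2 ((f.1.norm_coe_le_norm x.1).trans (hb f.1 f.2))
    · refine (LipschitzWith.uniformEquicontinuous _ C ?_).equicontinuous
      rintro ⟨_, f, rfl⟩
      exact (hL f.1 f.2).comp (LipschitzWith.subtype_val K) |>.weaken (by simp)
  have ht : TotallyBounded (Set.univ : Set A) := by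
    have := totallyBounded_preimage hr.isUniformInducing (hc.totallyBounded.subset subset_closure)
    simpa using this
  simpa using ht.image uniformContinuous_subtype_val

namespace ContDiffMapSupportedIn

variable {X F : Type*} [NormedAddCommGroup X] [NormedSpace ℝ X] [FiniteDimensional ℝ X]
  [NormedAddCommGroup F] [NormedSpace ℝ F] [FiniteDimensional ℝ F] {K : Compacts X}

instance _root_.ContinuousMultilinearMap.finiteDimensional_fin (i : ℕ) :
    FiniteDimensional ℝ (X [×i]→L[ℝ] F) :=
  FiniteDimensional.of_injective
    ({ toFun := ContinuousMultilinearMap.toMultilinearMap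
       map_add' := fun _ _ => rfl
       map_smul' := fun _ _ => rfl } :
      (X [×i]→L[ℝ] F) →ₗ[ℝ] MultilinearMap ℝ (fun _ : Fin i => X) F)
    ContinuousMultilinearMap.toMultilinearMap_injective

/-- The bound on order `i + 1` is a Lipschitz constant for the derivative of order `i`, so each
order separately satisfies Arzelà–Ascoli. -/
theorem totallyBounded_of_norm_iteratedFDeriv_le (M : ℕ → ℝ) :
    TotallyBounded {φ : 𝓓_{K}(X, F) | ∀ i x, ‖iteratedFDeriv ℝ i φ x‖ ≤ M i} := by
  -- With ultrafilters, total boundedness becomes a Cauchy condition, which can be tested one order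
  -- at a time without a diagonal argument.
  rw [totallyBounded_iff_ultrafilter]
  intro l hl
  rw [cauchy_iff_structureMapCLM]
  intro i
  refine totallyBounded_iff_ultrafilter.1 ?_ (l.map (structureMapCLM ℝ ⊤ i))
    (le_principal_iff.2 (image_mem_map (le_principal_iff.1 hl)))
  refine BoundedContinuousFunction.totallyBounded_of_lipschitz_of_support K.isCompact
    (M := max (M i) 0) (C := (M (i + 1)).toNNReal) ?_ ?_ ?_
  · rintro _ ⟨φ, hφ, rfl⟩
    refine (BoundedContinuousFunction.norm_le (le_max_right _ _)).2 fun x => ?_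
    rw [structureMapCLM_top_apply]
    exact (hφ i x).trans (le_max_left _ _)
  · rintro _ ⟨φ, hφ, rfl⟩
    rw [structureMapCLM_top_apply]
    refine lipschitzWith_of_nnnorm_fderiv_le (𝕜 := ℝ)
      (φ.contDiff.differentiable_iteratedFDeriv (by exact_mod_cast WithTop.coe_lt_top i))
      fun x => ?_
    rw [← NNReal.coe_le_coe, coe_nnnorm, norm_fderiv_iteratedFDeriv]
    exact (hφ (i + 1) x).trans (Real.le_coe_toNNReal _)
  · rintro _ ⟨φ, -, rfl⟩ x hx
    rw [structureMapCLM_top_apply]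
    exact φ.iteratedFDeriv_zero_on_compl hx

/-- On a Fréchet–Montel space such as `𝓓_K`, pointwise convergence of functionals is uniform
on bounded sets. -/
theorem exists_limit_uniform_of_tendsto {L : ℕ → 𝓓_{K}(X, ℂ) →L[ℂ] ℂ}
    {ℓ : 𝓓_{K}(X, ℂ) → ℂ} (h : ∀ φ, Tendsto (fun k => L k φ) atTop (𝓝 (ℓ φ))) :
    ∃ L₀ : 𝓓_{K}(X, ℂ) →L[ℂ] ℂ, ⇑L₀ = ℓ ∧ ∀ M : ℕ → ℝ, ∀ ε > 0, ∀ᶠ k in atTop,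
      ∀ φ : 𝓓_{K}(X, ℂ), (∀ i x, ‖iteratedFDeriv ℝ i φ x‖ ≤ M i) → ‖L k φ - L₀ φ‖ ≤ ε := by
  have hpi : Tendsto (fun k φ => L k φ) atTop (𝓝 ℓ) := tendsto_pi_nhds.2 h
  refine ⟨continuousLinearMapOfTendsto L hpi, rfl, fun M ε hε => ?_⟩
  -- Pointwise convergent sequences are pointwise bounded, so Banach–Steinhaus applies. A finite net
  -- modulo `V` then reduces uniform convergence to finitely many points; the four errors, two from
  -- the net point and two from `V`, are at most `ε / 4` in total size each way, hence at most `ε`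
  -- together.
  have heq : UniformEquicontinuous ((↑) ∘ L : ℕ → 𝓓_{K}(X, ℂ) → ℂ) :=
    PolynormableSpace.banach_steinhaus fun φ => (h φ).isVonNBounded_range ℂ
  obtain ⟨V, hV, hVL⟩ : ∃ V ∈ 𝓝 (0 : 𝓓_{K}(X, ℂ)), ∀ φ ∈ V, ∀ k, ‖L k φ‖ < ε / 4 := by
    have h0 := Metric.equicontinuousAt_iff_right.1 (heq.equicontinuous 0) (ε / 4) (by positivity)
    exact ⟨_, h0, fun φ hφ k => by simpa using hφ k⟩
  have hVL₀ : ∀ φ ∈ V, ‖ℓ φ‖ ≤ ε / 4 := fun φ hφ =>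
    le_of_tendsto (h φ).norm (Eventually.of_forall fun k => (hVL φ hφ k).le)
  obtain ⟨t, ht, htV⟩ := totallyBounded_iff_subset_finite_iUnion_nhds_zero.1
    (totallyBounded_of_norm_iteratedFDeriv_le (X := X) (F := ℂ) (K := K) M) V hV
  have hfin : ∀ᶠ k in atTop, ∀ y ∈ t, ‖L k y - ℓ y‖ < ε / 4 := by
    rw [eventually_all_finite ht]
    intro y _
    have := Metric.tendsto_nhds.1 (h y) (ε / 4) (by positivity)
    simpa [dist_eq_norm] using this
  filter_upwards [hfin] with k hk φ hφ
  obtain ⟨y, hy, v, hv, rfl⟩ : ∃ y ∈ t, ∃ v ∈ V, y + v = φ := by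
    have := htV hφ
    simp only [Set.mem_iUnion] at this
    obtain ⟨y, hy, v, hv, hvy⟩ := this
    exact ⟨y, hy, v, hv, hvy⟩
  change ‖L k (y + v) - continuousLinearMapOfTendsto L hpi (y + v)‖ ≤ ε
  rw [map_add, map_add]
  change ‖L k y + L k v - (ℓ y + ℓ v)‖ ≤ ε
  have h1 := hk y hy
  have h2 := hVL v hv k
  have h3 := hVL₀ v hv
  have : L k y + L k v - (ℓ y + ℓ v) = (L k y - ℓ y) + (L k v - ℓ v) := by ring
  rw [this]
  linarith [norm_add_le (L k y - ℓ y) (L k v - ℓ v), norm_sub_le (L k v) (ℓ v)]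

end ContDiffMapSupportedIn

/-! ### Taylor remainders and iterated derivatives -/

section Taylor

universe u

/-- The first order Taylor remainder of a smooth function is `o(v)` together with all its
derivatives, uniformly on compact sets. -/
theorem ContDiff.eventually_norm_iteratedFDeriv_taylor_remainder_le {X : Type u}
    [NormedAddCommGroup X] [NormedSpace ℝ X] {K : Set X} (hK : IsCompact K) {ε : ℝ} (hε : 0 < ε)
    (i : ℕ) {F : Type u} [NormedAddCommGroup F] [NormedSpace ℝ F] {h : X → F}
    (hh : ContDiff ℝ ∞ h) :
    ∀ᶠ v in 𝓝 (0 : X), ∀ z ∈ K,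
      ‖iteratedFDeriv ℝ i (fun y => h (v + y) - h y - fderiv ℝ h y v) z‖ ≤ ε * ‖v‖ := by
  induction i generalizing F with
  | zero =>
    have hc : Continuous (fderiv ℝ h) := hh.continuous_fderiv (by simp)
    have hu := hK.uniformContinuousAt_of_continuousAt (fderiv ℝ h)
      (fun a _ => hc.continuousAt) (Metric.dist_mem_uniformity hε)
    obtain ⟨δ, hδ, hδu⟩ := Metric.mem_uniformity_dist.1 hu
    filter_upwards [Metric.ball_mem_nhds (0 : X) hδ] with v hv z hz
    rw [norm_iteratedFDeriv_zero]
    rw [mem_ball_zero_iff] at hv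
    have hd := hh.differentiable (by simp)
    -- Mean value inequality on the ball of radius `‖v‖` about `z`, where `fderiv ℝ h` differs from
    -- its value at `z` by at most `ε`.
    have := (convex_closedBall z ‖v‖).norm_image_sub_le_of_norm_hasFDerivWithin_le'
      (f := h) (f' := fderiv ℝ h) (φ := fderiv ℝ h z) (C := ε) (x := z) (y := v + z)
      (fun w _ => (hd w).hasFDerivAt.hasFDerivWithinAt) (fun w hw => ?_)
      (Metric.mem_closedBall_self (norm_nonneg v)) (by simp)
    · simpa using this
    · have hzw : Dist.dist z w < δ := by
        rw [dist_comm]; exact (Metric.mem_closedBall.1 hw).trans_lt hv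
      have := hδu hzw hz
      rw [← dist_eq_norm, dist_comm]
      exact le_of_lt this
  | succ i ih =>
    have hd := hh.differentiable (by simp)
    have hh' : ContDiff ℝ ∞ (fderiv ℝ h) := hh.fderiv_right (by simp)
    filter_upwards [ih hh'] with v hv z hz
    -- By symmetry of the second derivative, the derivative of the remainder of `h` is the remainder
    -- of `fderiv ℝ h`. The induction thus changes the target to `X →L[ℝ] F`, which is why `X` and
    -- `F` share a universe.
    rw [← norm_iteratedFDeriv_fderiv]
    convert hv z hz using 3
    ext y w
    have h2 := hh'.differentiable (by simp)
    have e1 : HasFDerivAt (fun y => h (v + y)) (fderiv ℝ h (v + y)) y := by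
      exact (hd (v + y)).hasFDerivAt.comp y ((hasFDerivAt_id y).const_add v)
    have e2 : HasFDerivAt (fun y => fderiv ℝ h y v) ((fderiv ℝ (fderiv ℝ h) y).flip v) y := by
      simpa using (h2 y).hasFDerivAt.clm_apply (hasFDerivAt_const v y)
    have e3 := ((e1.sub (hd y).hasFDerivAt).sub e2).fderiv
    rw [show (fun y => h (v + y) - h y - fderiv ℝ h y v) =
      ((fun y => h (v + y)) - h) - fun y => fderiv ℝ h y v from rfl, e3]
    have hs : IsSymmSndFDerivAt ℝ h y :=
      (hh.contDiffAt).isSymmSndFDerivAt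
        (by rw [minSmoothness_of_isRCLikeNormedField]; exact WithTop.coe_le_coe.2 le_top)
    simp [hs.eq]

end Taylor

section

variable {X F : Type*} [NormedAddCommGroup X] [NormedSpace ℝ X] [NormedAddCommGroup F]
  [NormedSpace ℝ F]

theorem norm_iteratedFDeriv_iteratedFDeriv (f : X → F) (i j : ℕ) (x : X) :
    ‖iteratedFDeriv ℝ i (iteratedFDeriv ℝ j f) x‖ = ‖iteratedFDeriv ℝ (i + j) f x‖ := by
  induction j generalizing i with
  | zero =>
    rw [iteratedFDeriv_zero_eq_comp, LinearIsometryEquiv.norm_iteratedFDeriv_comp_left]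
    rfl
  | succ j ih =>
    let I : (X →L[ℝ] (X [×j]→L[ℝ] F)) ≃ₗᵢ[ℝ] (X [×(j + 1)]→L[ℝ] F) :=
      (continuousMultilinearCurryLeftEquiv ℝ (fun _ : Fin (j + 1) => X) F).symm
    have hI : iteratedFDeriv ℝ (j + 1) f = I ∘ fderiv ℝ (iteratedFDeriv ℝ j f) :=
      iteratedFDeriv_succ_eq_comp_left
    have hn := LinearIsometryEquiv.norm_iteratedFDeriv_comp_left (𝕜 := ℝ)
      (F := X →L[ℝ] (X [×j]→L[ℝ] F)) (G := X [×(j + 1)]→L[ℝ] F) I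
      (fderiv ℝ (iteratedFDeriv ℝ j f)) x i
    rw [hI, hn, norm_iteratedFDeriv_fderiv, ih, show i + 1 + j = i + (j + 1) by omega]

theorem ContDiff.norm_iteratedFDeriv_iteratedFDeriv_apply_le {f : X → F} (hf : ContDiff ℝ ∞ f)
    (i : ℕ) {j : ℕ} (v : Fin j → X) (x : X) :
    ‖iteratedFDeriv ℝ i (fun y => iteratedFDeriv ℝ j f y v) x‖ ≤
      (∏ l, ‖v l‖) * ‖iteratedFDeriv ℝ (i + j) f x‖ := by
  let A := ContinuousMultilinearMap.apply ℝ (fun _ : Fin j => X) F v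
  have hA : ‖A‖ ≤ ∏ l, ‖v l‖ := by
    refine ContinuousLinearMap.opNorm_le_bound _ (Finset.prod_nonneg fun _ _ => norm_nonneg _) ?_
    intro g
    rw [mul_comm]
    exact g.le_opNorm v
  have hj : ContDiff ℝ ∞ (iteratedFDeriv ℝ j f) := hf.iteratedFDeriv_right (by exact_mod_cast le_top)
  calc _ = ‖iteratedFDeriv ℝ i (A ∘ iteratedFDeriv ℝ j f) x‖ := rfl
    _ ≤ ‖A‖ * ‖iteratedFDeriv ℝ i (iteratedFDeriv ℝ j f) x‖ :=
        A.norm_iteratedFDeriv_comp_left hj.contDiffAt (by exact_mod_cast le_top)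
    _ ≤ _ := by
        rw [norm_iteratedFDeriv_iteratedFDeriv]
        gcongr

end

/-- The space of smooth functions `X → ℂ`, with no growth condition. -/
def SmoothFun (X : Type*) [NormedAddCommGroup X] [NormedSpace ℝ X] : Submodule ℂ (X → ℂ) where
  carrier := {h | ContDiff ℝ ∞ h}
  add_mem' {f g} (hf : ContDiff ℝ ∞ f) (hg : ContDiff ℝ ∞ g) := show ContDiff ℝ ∞ (f + g) from
    hf.add hg
  zero_mem' := show ContDiff ℝ ∞ (0 : X → ℂ) from contDiff_zero_fun
  smul_mem' c f (hf : ContDiff ℝ ∞ f) := show ContDiff ℝ ∞ (c • f) from hf.const_smul c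

/-! ### Convolution of smooth functions with compactly supported functionals of finite order -/

namespace SmoothFun

section

variable {X : Type*} [NormedAddCommGroup X] [NormedSpace ℝ X]

theorem contDiff (h : SmoothFun X) : ContDiff ℝ ∞ (h : X → ℂ) := h.2

/-- The translate `y ↦ h (x + y)`. -/
def translate (x : X) (h : SmoothFun X) : SmoothFun X :=
  ⟨fun y => (h : X → ℂ) (x + y), (SmoothFun.contDiff h).comp (contDiff_const.add contDiff_id)⟩

/-- The iterated directional derivative `y ↦ D^j h(y)(v₁, …, v_j)`. -/
noncomputable def dirDeriv {j : ℕ} (v : Fin j → X) (h : SmoothFun X) : SmoothFun X :=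
  ⟨fun y => iteratedFDeriv ℝ j (h : X → ℂ) y v,
    show ContDiff ℝ ∞ _ from
      (ContinuousMultilinearMap.apply ℝ (fun _ : Fin j => X) ℂ v).contDiff.comp
      ((SmoothFun.contDiff h).iteratedFDeriv_right (m := ∞) (by exact_mod_cast le_top))⟩

theorem iteratedFDeriv_translate (x : X) (h : SmoothFun X) (i : ℕ) (y : X) :
    iteratedFDeriv ℝ i (translate x h : X → ℂ) y = iteratedFDeriv ℝ i (h : X → ℂ) (x + y) :=
  iteratedFDeriv_comp_add_left i x y

theorem norm_iteratedFDeriv_dirDeriv_le {j : ℕ} (v : Fin j → X) (h : SmoothFun X) (i : ℕ) (y : X) :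
    ‖iteratedFDeriv ℝ i (dirDeriv v h : X → ℂ) y‖ ≤
      (∏ l, ‖v l‖) * ‖iteratedFDeriv ℝ (i + j) (h : X → ℂ) y‖ :=
  (SmoothFun.contDiff h).norm_iteratedFDeriv_iteratedFDeriv_apply_le i v y

theorem dirDeriv_one_apply (v : X) (h : SmoothFun X) (y : X) :
    (dirDeriv ![v] h : X → ℂ) y = fderiv ℝ (h : X → ℂ) y v := by
  simp [dirDeriv, iteratedFDeriv_one_apply]

/-- `Λ` is bounded by `C` times the sup of the derivatives of order at most `m` on `K`. -/
def IsBoundedBy (Λ : SmoothFun X →ₗ[ℂ] ℂ) (K : Set X) (m : ℕ) (C : ℝ) : Prop :=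
  0 ≤ C ∧ ∀ (h : SmoothFun X) (M : ℝ), 0 ≤ M →
    (∀ i ≤ m, ∀ y ∈ K, ‖iteratedFDeriv ℝ i (h : X → ℂ) y‖ ≤ M) → ‖Λ h‖ ≤ C * M

/-- The function `x ↦ Λ(h(x + ·))`. -/
def conv (Λ : SmoothFun X →ₗ[ℂ] ℂ) (h : SmoothFun X) : X → ℂ :=
  fun x => Λ (translate x h)

theorem conv_add (Λ : SmoothFun X →ₗ[ℂ] ℂ) (h₁ h₂ : SmoothFun X) :
    conv Λ (h₁ + h₂) = conv Λ h₁ + conv Λ h₂ :=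
  funext fun x => Λ.map_add (translate x h₁) (translate x h₂)

theorem conv_smul (Λ : SmoothFun X →ₗ[ℂ] ℂ) (c : ℂ) (h : SmoothFun X) :
    conv Λ (c • h) = c • conv Λ h :=
  funext fun x => Λ.map_smul c (translate x h)

variable {Λ : SmoothFun X →ₗ[ℂ] ℂ} {K : Set X} {m : ℕ} {C : ℝ}

theorem IsBoundedBy.norm_conv_dirDeriv_le (hΛ : IsBoundedBy Λ K m C) (h : SmoothFun X) {j : ℕ}
    (v : Fin j → X) (x : X) {M : ℝ} (hM : 0 ≤ M)
    (hh : ∀ i ≤ m + j, ∀ y ∈ K, ‖iteratedFDeriv ℝ i (h : X → ℂ) (x + y)‖ ≤ M) :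
    ‖conv Λ (dirDeriv v h) x‖ ≤ C * M * ∏ l, ‖v l‖ := by
  have hv : 0 ≤ ∏ l, ‖v l‖ := Finset.prod_nonneg fun _ _ => norm_nonneg _
  have := hΛ.2 (translate x (dirDeriv v h)) ((∏ l, ‖v l‖) * M) (by positivity) ?_
  · rw [conv]; linarith
  · intro i hi y hy
    rw [iteratedFDeriv_translate]
    exact (norm_iteratedFDeriv_dirDeriv_le v h i (x + y)).trans
      (mul_le_mul_of_nonneg_left (hh _ (by omega) y hy) hv)

end

section

variable {X : Type} [NormedAddCommGroup X] [NormedSpace ℝ X] [FiniteDimensional ℝ X]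
  {Λ : SmoothFun X →ₗ[ℂ] ℂ} {K : Set X} {m : ℕ} {C : ℝ}

/-- The derivative `v ↦ Λ(∂_v h(x + ·))` of `conv Λ h` at `x`. -/
noncomputable def convFDeriv (Λ : SmoothFun X →ₗ[ℂ] ℂ) (h : SmoothFun X) (x : X) : X →L[ℝ] ℂ :=
  LinearMap.toContinuousLinearMap
    { toFun := fun v => conv Λ (dirDeriv ![v] h) x
      map_add' := fun v w => by
        have : translate x (dirDeriv ![v + w] h) =
            translate x (dirDeriv ![v] h) + translate x (dirDeriv ![w] h) := by
          ext y
          change (dirDeriv ![v + w] h : X → ℂ) (x + y) =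
            (dirDeriv ![v] h : X → ℂ) (x + y) + (dirDeriv ![w] h : X → ℂ) (x + y)
          simp [dirDeriv_one_apply]
        rw [conv, this, map_add]
        rfl
      map_smul' := fun c v => by
        have : translate x (dirDeriv ![c • v] h) = (c : ℂ) • translate x (dirDeriv ![v] h) := by
          ext y
          change (dirDeriv ![c • v] h : X → ℂ) (x + y) =
            (c : ℂ) * (dirDeriv ![v] h : X → ℂ) (x + y)
          simp [dirDeriv_one_apply]
        rw [conv, this, map_smul]
        simp [conv] }

/-- The increment minus its linear part is `Λ` of the translated Taylor remainder of `h`, which is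
`o(v)` in every derivative that the bound on `Λ` involves. -/
theorem IsBoundedBy.hasFDerivAt_conv (hΛ : IsBoundedBy Λ K m C) (hK : IsCompact K)
    (h : SmoothFun X) (x : X) : HasFDerivAt (conv Λ h) (convFDeriv Λ h x) x := by
  rw [hasFDerivAt_iff_isLittleO_nhds_zero, Asymptotics.isLittleO_iff]
  intro ε hε
  have hC := hΛ.1
  have hxK : IsCompact ((fun y => x + y) '' K) := hK.image (by fun_prop)
  -- Dividing by `C + 1` instead of `C` covers `C = 0`.
  have hev : ∀ᶠ v in 𝓝 (0 : X), ∀ i ∈ Finset.range (m + 1), ∀ z ∈ (fun y => x + y) '' K,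
      ‖iteratedFDeriv ℝ i (fun y => (h : X → ℂ) (v + y) - (h : X → ℂ) y -
        fderiv ℝ (h : X → ℂ) y v) z‖ ≤ ε / (C + 1) * ‖v‖ := by
    rw [eventually_all_finset]
    intro i _
    exact (SmoothFun.contDiff h).eventually_norm_iteratedFDeriv_taylor_remainder_le hxK (by positivity) i
  filter_upwards [hev] with v hv
  let R : SmoothFun X := ⟨fun y => (h : X → ℂ) (v + y) - (h : X → ℂ) y -
        fderiv ℝ (h : X → ℂ) y v, by
    refine ContDiff.sub (ContDiff.sub ((SmoothFun.contDiff h).comp (contDiff_const.add contDiff_id))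
      (SmoothFun.contDiff h)) ?_
    exact ((SmoothFun.contDiff h).fderiv_right (by simp)).clm_apply contDiff_const⟩
  have hR : translate x R =
      translate (x + v) h - translate x h - translate x (dirDeriv ![v] h) := by
    ext y
    change (h : X → ℂ) (v + (x + y)) - (h : X → ℂ) (x + y) - fderiv ℝ (h : X → ℂ) (x + y) v =
      (h : X → ℂ) (x + v + y) - (h : X → ℂ) (x + y) - (dirDeriv ![v] h : X → ℂ) (x + y)
    rw [dirDeriv_one_apply, ← add_assoc, add_comm v x]
  have hb := hΛ.2 (translate x R) (ε / (C + 1) * ‖v‖) (by positivity) fun i hi y hy => by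
    rw [iteratedFDeriv_translate]
    exact hv i (Finset.mem_range.2 (by omega)) _ ⟨y, hy, rfl⟩
  rw [hR, map_sub, map_sub] at hb
  refine hb.trans ?_
  have : C * (ε / (C + 1) * ‖v‖) = (C / (C + 1)) * (ε * ‖v‖) := by ring
  rw [this]
  have h1 : C / (C + 1) ≤ 1 := by rw [div_le_one (by positivity)]; linarith
  calc _ ≤ 1 * (ε * ‖v‖) := by gcongr
    _ = _ := one_mul _

theorem IsBoundedBy.fderiv_conv_apply (hΛ : IsBoundedBy Λ K m C) (hK : IsCompact K)
    (h : SmoothFun X) (x v : X) : fderiv ℝ (conv Λ h) x v = conv Λ (dirDeriv ![v] h) x := by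
  rw [(hΛ.hasFDerivAt_conv hK h x).fderiv]
  rfl

/-- A directional derivative of `conv Λ h` is again of the form `conv Λ h'`, so differentiability
bootstraps to every order. -/
theorem IsBoundedBy.contDiff_conv (hΛ : IsBoundedBy Λ K m C) (hK : IsCompact K)
    (h : SmoothFun X) : ContDiff ℝ ∞ (conv Λ h) := by
  rw [contDiff_infty]
  intro k
  induction k generalizing h with
  | zero =>
    exact contDiff_zero.2
      (continuous_iff_continuousAt.2 fun x => (hΛ.hasFDerivAt_conv hK h x).continuousAt)
  | succ k ih =>
    have e : ((k + 1 : ℕ) : WithTop ℕ∞) = (k : WithTop ℕ∞) + 1 := by push_cast; rfl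
    rw [e, contDiff_succ_iff_fderiv]
    refine ⟨fun x => (hΛ.hasFDerivAt_conv hK h x).differentiableAt, by simp, ?_⟩
    rw [contDiff_clm_apply_iff]
    intro v
    simp_rw [hΛ.fderiv_conv_apply hK h _ v]
    exact ih _

theorem IsBoundedBy.iteratedFDeriv_conv (hΛ : IsBoundedBy Λ K m C) (hK : IsCompact K)
    (h : SmoothFun X) {j : ℕ} (v : Fin j → X) (x : X) :
    iteratedFDeriv ℝ j (conv Λ h) x v = conv Λ (dirDeriv v h) x := by
  induction j generalizing x with
  | zero =>
    rw [iteratedFDeriv_zero_apply]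
    rfl
  | succ j ih =>
    have hd : DifferentiableAt ℝ (iteratedFDeriv ℝ j (conv Λ h)) x :=
      ((hΛ.contDiff_conv hK h).differentiable_iteratedFDeriv
        (by exact_mod_cast WithTop.coe_lt_top j)) x
    have hd' (y : X) : DifferentiableAt ℝ (iteratedFDeriv ℝ j (h : X → ℂ)) y :=
      ((SmoothFun.contDiff h).differentiable_iteratedFDeriv (by exact_mod_cast WithTop.coe_lt_top j)) y
    have key : dirDeriv ![v 0] (dirDeriv (Fin.tail v) h) = dirDeriv v h := by
      ext y
      rw [dirDeriv_one_apply]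
      change fderiv ℝ (fun z => iteratedFDeriv ℝ j (h : X → ℂ) z (Fin.tail v)) y (v 0) =
        iteratedFDeriv ℝ (j + 1) (h : X → ℂ) y v
      rw [iteratedFDeriv_succ_apply_left]
      exact DFunLike.congr_fun
        (((ContinuousMultilinearMap.apply ℝ (fun _ : Fin j => X) ℂ (Fin.tail v)).hasFDerivAt.comp y
          (hd' y).hasFDerivAt).fderiv) (v 0)
    rw [iteratedFDeriv_succ_apply_left, ← key, ← hΛ.fderiv_conv_apply hK]
    have : conv Λ (dirDeriv (Fin.tail v) h) =
        fun y => iteratedFDeriv ℝ j (conv Λ h) y (Fin.tail v) := funext fun y => (ih _ y).symm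
    rw [this]
    exact (DFunLike.congr_fun
        (((ContinuousMultilinearMap.apply ℝ (fun _ : Fin j => X) ℂ (Fin.tail v)).hasFDerivAt.comp x
          hd.hasFDerivAt).fderiv) (v 0)).symm

theorem IsBoundedBy.norm_iteratedFDeriv_conv_le (hΛ : IsBoundedBy Λ K m C) (hK : IsCompact K)
    (h : SmoothFun X) (j : ℕ) (x : X) {M : ℝ} (hM : 0 ≤ M)
    (hh : ∀ i ≤ m + j, ∀ y ∈ K, ‖iteratedFDeriv ℝ i (h : X → ℂ) (x + y)‖ ≤ M) :
    ‖iteratedFDeriv ℝ j (conv Λ h) x‖ ≤ C * M := by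
  refine ContinuousMultilinearMap.opNorm_le_bound (mul_nonneg hΛ.1 hM) fun v => ?_
  rw [hΛ.iteratedFDeriv_conv hK]
  exact hΛ.norm_conv_dirDeriv_le h v x hM hh

end

end SmoothFun

/-! ### Demi-linear functionals: boundedness and uniform convergence -/

section DemiLinear

variable {E : Type*} [AddCommGroup E] [Module ℂ E] [TopologicalSpace E] {γ : ℂ → ℂ} {U : Set E}
  {g : E → ℂ}

/-- Demi-linearity with `t = 1` controls `g((N + 1)η)` by `g(Nη)` and `g(η)`. This is the substitute
for homogeneity. -/
theorem IsDemiLinear.exists_norm_natCast_smul_le {E : Type*} [AddCommGroup E] [Module ℂ E]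
    {γ : ℂ → ℂ} {U : Set E} {g : E → ℂ} (hg : IsDemiLinear γ U g) (N : ℕ) :
    ∃ R : ℝ, 0 ≤ R ∧ ∀ η ∈ U, ‖g η‖ < 1 → ‖g ((N : ℂ) • η)‖ ≤ R := by
  induction N with
  | zero => exact ⟨0, le_rfl, fun η _ _ => by simp [hg.1]⟩
  | succ N ih =>
    obtain ⟨R, hR, h⟩ := ih
    refine ⟨(1 + ‖γ 1‖) * R + ‖γ 1‖, by positivity, fun η hη h1 => ?_⟩
    obtain ⟨r, s, hr, hs, e⟩ := hg.2 ((N : ℂ) • η) η hη 1 (by simp)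
    have : ((N + 1 : ℕ) : ℂ) • η = (N : ℂ) • η + (1 : ℂ) • η := by
      rw [← add_smul]; push_cast; rfl
    rw [this, e]
    have hr' : ‖r‖ ≤ 1 + ‖γ 1‖ := by
      have := norm_add_le (r - 1) 1
      rw [sub_add_cancel, norm_one] at this
      linarith
    calc _ ≤ ‖r‖ * ‖g ((N : ℂ) • η)‖ + ‖s‖ * ‖g η‖ := by
          simpa only [norm_mul] using norm_add_le (r * g ((N : ℂ) • η)) (s * g η)
      _ ≤ (1 + ‖γ 1‖) * R + ‖γ 1‖ * 1 := by
          gcongr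
          exact h η hη h1
      _ = _ := by ring

/-- A demi-distribution is bounded on bounded sets. -/
theorem IsDemiLinear.exists_norm_le_of_isVonNBounded (hU : U ∈ 𝓝 0) (hc : Continuous g)
    (hg : IsDemiLinear γ U g) {S : Set E} (hS : IsVonNBounded ℂ S) :
    ∃ R : ℝ, 0 ≤ R ∧ ∀ ξ ∈ S, ‖g ξ‖ ≤ R := by
  have hV : U ∩ {η | ‖g η‖ < 1} ∈ 𝓝 (0 : E) := by
    refine inter_mem hU ((isOpen_lt hc.norm continuous_const).mem_nhds ?_)
    simp [hg.1]
  -- The neighbourhood absorbs `S`, and an integer dilation `N ≥ r` suffices, so every `ξ ∈ S` is `N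
  -- • η` with `η ∈ U` and `‖g η‖ < 1`.
  obtain ⟨r, hr⟩ := (hS hV).exists_pos.imp fun r h => h.2
  obtain ⟨N, hN⟩ := exists_nat_ge r
  obtain ⟨R, hR, h⟩ := hg.exists_norm_natCast_smul_le N
  refine ⟨R, hR, fun ξ hξ => ?_⟩
  obtain ⟨η, hη, rfl⟩ := hr (N : ℂ) (by simpa using hN) hξ
  exact h η hη.1 hη.2

theorem IsDemiLinear.tendstoUniformlyOn [ContinuousConstSMul ℂ E] (hγ : γ ∈ CZero)
    (hU : U ∈ 𝓝 0) (hc : Continuous g) (hg : IsDemiLinear γ U g)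
    {ι α : Type*} {l : Filter ι} {T : ι → α → E} {T₀ : α → E} {B : Set α}
    (hB : IsVonNBounded ℂ (T₀ '' B))
    (hT : ∀ V ∈ 𝓝 (0 : E), ∀ᶠ k in l, ∀ ξ ∈ B, T k ξ - T₀ ξ ∈ V) :
    TendstoUniformlyOn (fun k ξ => g (T k ξ)) (fun ξ => g (T₀ ξ)) l B := by
  rw [Metric.tendstoUniformlyOn_iff]
  intro ε hε
  obtain ⟨R, hR, hgR⟩ := hg.exists_norm_le_of_isVonNBounded hU hc hB
  -- A single `t` serves for all `k` and `ξ`: it is nonzero, so that `t • V` is a neighbourhood of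
  -- 0, and the final error is at most `‖γ t‖ * (R + 1)`.
  obtain ⟨t, ht0, ht1, htγ⟩ : ∃ t : ℂ, t ≠ 0 ∧ ‖t‖ ≤ 1 ∧ ‖γ t‖ < ε / (R + 1) := by
    have h1 : ∀ᶠ t in 𝓝 (0 : ℂ), ‖γ t‖ < ε / (R + 1) := by
      have := Metric.tendsto_nhds.1 hγ.2.1 (ε / (R + 1)) (by positivity)
      simpa [dist_eq_norm] using this
    have h2 : ∀ᶠ t in 𝓝 (0 : ℂ), ‖t‖ ≤ 1 := by
      filter_upwards [Metric.closedBall_mem_nhds (0 : ℂ) one_pos] with t ht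
      simpa using ht
    obtain ⟨t, ⟨ha, hb⟩, hc⟩ :=
      (((h1.and h2).filter_mono nhdsWithin_le_nhds).and
        (self_mem_nhdsWithin (s := ({0}ᶜ : Set ℂ)))).exists
    exact ⟨t, hc, hb, ha⟩
  have hV : U ∩ {η | ‖g η‖ < 1} ∈ 𝓝 (0 : E) := by
    refine inter_mem hU ((isOpen_lt hc.norm continuous_const).mem_nhds ?_)
    simp [hg.1]
  filter_upwards [hT _ ((set_smul_mem_nhds_zero_iff ht0).2 hV)] with k hk ξ hξ
  obtain ⟨η, ⟨hηU, hη1⟩, e⟩ := hk ξ hξ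
  obtain ⟨r, s, hr, hs, hgrs⟩ := hg.2 (T₀ ξ) η hηU t ht1
  have e' : T k ξ = T₀ ξ + t • η := by
    have e : t • η = T k ξ - T₀ ξ := e
    rw [e]; abel
  rw [dist_comm, dist_eq_norm, e', hgrs]
  have : r * g (T₀ ξ) + s * g η - g (T₀ ξ) = (r - 1) * g (T₀ ξ) + s * g η := by ring
  rw [this]
  calc _ ≤ ‖r - 1‖ * ‖g (T₀ ξ)‖ + ‖s‖ * ‖g η‖ := by
        simpa only [norm_mul] using norm_add_le ((r - 1) * g (T₀ ξ)) (s * g η)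
    _ ≤ ‖γ t‖ * R + ‖γ t‖ * 1 := by
        gcongr
        · exact hgR _ ⟨ξ, hξ, rfl⟩
        · exact le_of_lt hη1
    _ = ‖γ t‖ * (R + 1) := by ring
    _ < ε := (lt_div_iff₀ (by positivity)).1 htγ

theorem tendstoUniformlyOn_of_mem_demiSpan [ContinuousConstSMul ℂ E] (hγ : γ ∈ CZero)
    (hU : U ∈ 𝓝 0) (hg : g ∈ demiSpan γ U)
    {ι α : Type*} {l : Filter ι} {T : ι → α → E} {T₀ : α → E} {B : Set α}
    (hB : IsVonNBounded ℂ (T₀ '' B))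
    (hT : ∀ V ∈ 𝓝 (0 : E), ∀ᶠ k in l, ∀ ξ ∈ B, T k ξ - T₀ ξ ∈ V) :
    TendstoUniformlyOn (fun k ξ => g (T k ξ)) (fun ξ => g (T₀ ξ)) l B := by
  induction hg using Submodule.span_induction with
  | mem g hg => exact hg.2.tendstoUniformlyOn hγ hU hg.1 hB hT
  | zero => exact (tendsto_const_nhds : Tendsto _ l (𝓝 (0 : ℂ))).tendstoUniformlyOn_const B
  | add g₁ g₂ _ _ h₁ h₂ => exact h₁.add h₂
  | smul c g _ h =>
    exact (uniformContinuous_const_smul c).comp_tendstoUniformlyOn h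

end DemiLinear

/-! ### Cutting off to `𝓓_K` -/

namespace SmoothFun

variable {X : Type*} [NormedAddCommGroup X] [NormedSpace ℝ X] {K : Compacts X}
  {χ : SmoothFun X}

/-- Multiplication by a smooth function supported in `K`, as a map into `𝓓_K`. -/
noncomputable def cutoff (χ : SmoothFun X) (hχ : Function.support (χ : X → ℂ) ⊆ K) :
    SmoothFun X →ₗ[ℂ] 𝓓_{K}(X, ℂ) where
  toFun h := .of_support_subset (f := fun x => (χ : X → ℂ) x * (h : X → ℂ) x)
    ((SmoothFun.contDiff χ).mul (SmoothFun.contDiff h))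
    fun x hx => hχ (left_ne_zero_of_mul hx)
  map_add' h₁ h₂ := by
    ext x
    exact mul_add ((χ : X → ℂ) x) ((h₁ : X → ℂ) x) ((h₂ : X → ℂ) x)
  map_smul' c h := by
    ext x
    exact mul_left_comm ((χ : X → ℂ) x) c ((h : X → ℂ) x)

theorem exists_norm_iteratedFDeriv_cutoff_le (hχ : Function.support (χ : X → ℂ) ⊆ K) (m : ℕ) :
    ∃ C : ℝ, 0 ≤ C ∧ ∀ (h : SmoothFun X) (M : ℝ), 0 ≤ M →
      (∀ i ≤ m, ∀ y ∈ K, ‖iteratedFDeriv ℝ i (h : X → ℂ) y‖ ≤ M) →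
      ∀ i ≤ m, ∀ x, ‖iteratedFDeriv ℝ i (cutoff χ hχ h) x‖ ≤ C * M := by
  have hA (j : ℕ) : ∃ A, ∀ y ∈ K, ‖iteratedFDeriv ℝ j (χ : X → ℂ) y‖ ≤ A :=
    K.isCompact.exists_bound_of_continuousOn
      ((SmoothFun.contDiff χ).continuous_iteratedFDeriv (by exact_mod_cast le_top)).continuousOn
  choose A hA using hA
  let B : ℝ := ∑ j ∈ Finset.range (m + 1), |A j|
  have hB : 0 ≤ B := Finset.sum_nonneg fun _ _ => abs_nonneg _
  have hAB (j : ℕ) (hj : j ≤ m) : A j ≤ B := (le_abs_self _).trans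
    (Finset.single_le_sum (f := fun j => |A j|) (fun _ _ => abs_nonneg _)
      (Finset.mem_range.2 (by omega)))
  -- Leibniz: the binomial coefficients of order `i` sum to `2 ^ i`, and `B` bounds all derivatives
  -- of `χ` of order at most `m` on `K`.
  refine ⟨2 ^ m * B, by positivity, fun h M hM hh i hi x => ?_⟩
  by_cases hx : x ∈ (K : Set X)
  · calc _ ≤ ∑ j ∈ Finset.range (i + 1), (i.choose j : ℝ) *
            ‖iteratedFDeriv ℝ j (χ : X → ℂ) x‖ * ‖iteratedFDeriv ℝ (i - j) (h : X → ℂ) x‖ :=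
          norm_iteratedFDeriv_mul_le (SmoothFun.contDiff χ) (SmoothFun.contDiff h) x
            (by exact_mod_cast le_top)
      _ ≤ ∑ j ∈ Finset.range (i + 1), (i.choose j : ℝ) * B * M := by
          gcongr with j hj
          · exact (hA j x hx).trans (hAB j (by have := Finset.mem_range.1 hj; omega))
          · exact hh _ (by omega) x hx
      _ = 2 ^ i * (B * M) := by
          simp_rw [mul_assoc]
          rw [← Finset.sum_mul, ← Nat.cast_sum, Nat.sum_range_choose]
          push_cast; rfl
      _ ≤ 2 ^ m * (B * M) := by
          gcongr
          norm_num
      _ = _ := by ring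
  · rw [ContDiffMapSupportedIn.iteratedFDeriv_zero_on_compl _ hx]
    simp only [Pi.zero_apply, norm_zero]
    positivity

/-- Continuity on `𝓓_K` means a bound by finitely many seminorms, that is, finite order. The order
and constant depend on `L`; no bound common to a sequence is needed later. -/
theorem exists_isBoundedBy_comp_cutoff (hχ : Function.support (χ : X → ℂ) ⊆ K)
    (L : 𝓓_{K}(X, ℂ) →L[ℂ] ℂ) :
    ∃ m C, IsBoundedBy (L.toLinearMap ∘ₗ cutoff χ hχ) (K : Set X) m C := by
  obtain ⟨s, C, -, hC⟩ := Seminorm.bound_of_continuous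
    (ContDiffMapSupportedIn.withSeminorms ℂ X ℂ ⊤ K) ((normSeminorm ℂ ℂ).comp L.toLinearMap)
    (continuous_norm.comp L.continuous)
  obtain ⟨D, hD, hcut⟩ := exists_norm_iteratedFDeriv_cutoff_le hχ (s.sup id)
  refine ⟨s.sup id, C * D, by positivity, fun h M hM hh => ?_⟩
  refine (hC (cutoff χ hχ h)).trans ?_
  rw [mul_assoc]
  refine mul_le_mul_of_nonneg_left ?_ C.2
  refine Seminorm.finset_sup_apply_le (by positivity) fun i hi => ?_
  rw [ContDiffMapSupportedIn.seminorm_top_le_iff ℂ (by positivity)]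
  exact fun x _ => hcut h M hM hh i (Finset.le_sup (f := id) hi) x

theorem exists_limit_uniform_of_tendsto [FiniteDimensional ℝ X]
    (hχ : Function.support (χ : X → ℂ) ⊆ K) {L : ℕ → 𝓓_{K}(X, ℂ) →L[ℂ] ℂ}
    {ℓ : 𝓓_{K}(X, ℂ) → ℂ} (hL : ∀ φ, Tendsto (fun k => L k φ) atTop (𝓝 (ℓ φ))) :
    ∃ L₀ : 𝓓_{K}(X, ℂ) →L[ℂ] ℂ, ⇑L₀ = ℓ ∧ ∀ M : ℕ → ℝ, ∀ ε > 0, ∀ᶠ k in atTop,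
      ∀ h : SmoothFun X, (∀ i, ∀ y ∈ K, ‖iteratedFDeriv ℝ i (h : X → ℂ) y‖ ≤ M i) →
        ‖L k (cutoff χ hχ h) - L₀ (cutoff χ hχ h)‖ ≤ ε := by
  obtain ⟨L₀, h₀, hu⟩ := ContDiffMapSupportedIn.exists_limit_uniform_of_tendsto hL
  choose C hC hcut using exists_norm_iteratedFDeriv_cutoff_le hχ
  refine ⟨L₀, h₀, fun M ε hε => ?_⟩
  filter_upwards [hu (fun i => C i * ∑ j ∈ Finset.range (i + 1), |M j|) ε hε] with k hk h hh
  refine hk _ fun i x => hcut i h _ (Finset.sum_nonneg fun _ _ => abs_nonneg _)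
    (fun j hj y hy => (hh j y hy).trans ((le_abs_self _).trans ?_)) i le_rfl x
  exact Finset.single_le_sum (f := fun j => |M j|) (fun _ _ => abs_nonneg _)
      (Finset.mem_range.2 (by omega))

end SmoothFun

/-! ### Vanishing of a functional away from its support -/

section Support

variable {X : Type*} [NormedAddCommGroup X] [NormedSpace ℝ X] [FiniteDimensional ℝ X]

open scoped Manifold

/-- A finite smooth partition of unity on a compact set, subordinate to a neighbourhood of each
point. -/
theorem IsCompact.exists_finset_smooth_partition {S : Set X} (hS : IsCompact S) {G : X → Set X}
    (hGo : ∀ x ∈ S, IsOpen (G x)) (hGm : ∀ x ∈ S, x ∈ G x) :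
    ∃ (t : Finset X) (ρ : t → X → ℝ), (∀ i ∈ t, i ∈ S) ∧ (∀ i, ContDiff ℝ ∞ (ρ i)) ∧
      (∀ i : t, tsupport (ρ i) ⊆ G i) ∧ ∀ x ∈ S, ∑ i, ρ i x = 1 := by
  obtain ⟨t, hts, htc⟩ := hS.elim_nhds_subcover G fun x hx => (hGo x hx).mem_nhds (hGm x hx)
  obtain ⟨ρ, hρ⟩ := SmoothPartitionOfUnity.exists_isSubordinate 𝓘(ℝ, X) hS.isClosed
    (fun i : t => G i) (fun i => hGo i (hts i i.2))
    (fun x hx => by simpa only [Set.mem_iUnion, Subtype.exists, exists_prop] using htc hx)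
  refine ⟨t, fun i => ρ i, hts, fun i => (ρ i).contMDiff.contDiff, hρ, fun x hx => ?_⟩
  rw [← finsum_eq_sum_of_fintype]
  exact ρ.sum_eq_one hx

/-- A functional on test functions that vanishes locally near the support of `ψ`
vanishes at `ψ`. -/
theorem TestFunction.map_eq_zero_of_locally {V : Type*} [AddCommMonoid V] [Module ℂ V]
    (Φ : 𝓓((⊤ : Opens X), ℂ) →ₗ[ℂ] V) (ψ : 𝓓((⊤ : Opens X), ℂ))
    (h : ∀ x ∈ tsupport ψ, ∃ G : Set X, IsOpen G ∧ x ∈ G ∧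
      ∀ ξ : 𝓓((⊤ : Opens X), ℂ), tsupport ξ ⊆ G → Φ ξ = 0) : Φ ψ = 0 := by
  choose! G hGo hGm hG using h
  obtain ⟨t, ρ, hts, hρc, hρG, hρ1⟩ :=
    ψ.hasCompactSupport.isCompact.exists_finset_smooth_partition hGo hGm
  let p (i : t) : 𝓓((⊤ : Opens X), ℂ) :=
    { toFun := fun x => (ρ i x : ℂ) * ψ x
      contDiff' := (Complex.ofRealCLM.contDiff.comp (hρc i)).mul ψ.contDiff
      hasCompactSupport' := ψ.hasCompactSupport.mul_left
      tsupport_subset' := fun _ _ => trivial }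
  have hp (i : t) : Φ (p i) = 0 := by
    refine hG i (hts i i.2) _ (subset_trans (closure_mono fun x hx => ?_) (hρG i))
    exact Complex.ofReal_ne_zero.1 (left_ne_zero_of_mul hx)
  have hsum : ψ = ∑ i, p i := by
    ext x
    have e : (∑ i, p i) x = ∑ i, p i x := by
      simp only [FunLike.coe_sum, Finset.sum_apply]
    rw [e]
    change ψ x = ∑ i, (ρ i x : ℂ) * ψ x
    rw [← Finset.sum_mul, ← Complex.ofReal_sum]
    by_cases hx : x ∈ tsupport ψ
    · rw [hρ1 x hx, Complex.ofReal_one, one_mul]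
    · rw [image_eq_zero_of_notMem_tsupport hx, mul_zero]
  rw [hsum, map_sum]
  exact Finset.sum_eq_zero fun i _ => hp i

/-- Test functions as Schwartz functions. -/
noncomputable def TestFunction.toSchwartzMapLM : 𝓓((⊤ : Opens X), ℂ) →ₗ[ℂ] 𝓢(X, ℂ) where
  toFun ψ := ψ.hasCompactSupport.toSchwartzMap ψ.contDiff
  map_add' _ _ := rfl
  map_smul' _ _ := rfl

theorem TestFunction.map_eq_zero_of_disjoint_dsupport (f : 𝓓((⊤ : Opens X), ℂ) →L[ℂ] ℂ)
    {ψ : 𝓓((⊤ : Opens X), ℂ)} (h : Disjoint (tsupport ψ) (dsupport f)) : f ψ = 0 := by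
  refine TestFunction.map_eq_zero_of_locally f.toLinearMap ψ fun x hx => ?_
  obtain ⟨G, hG, hGo, hxG⟩ := (notMem_dsupport_iff x).1 (h.notMem_of_mem_left hx)
  exact ⟨G, hGo, hxG, hG⟩

end Support

/-! ### Differences of convolutions, and the cutoff around the supports -/

namespace SmoothFun

theorem norm_map_le_of_scaled {X : Type*} [NormedAddCommGroup X] [NormedSpace ℝ X]
    {Δ : SmoothFun X →ₗ[ℂ] ℂ} {K : Set X} {M : ℕ → ℝ} (hM : ∀ i, 0 ≤ M i) {ε : ℝ}
    (H : ∀ h : SmoothFun X, (∀ i, ∀ y ∈ K, ‖iteratedFDeriv ℝ i (h : X → ℂ) y‖ ≤ M i) → ‖Δ h‖ ≤ ε)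
    {c : ℝ} (hc : 0 ≤ c) {h : SmoothFun X}
    (hh : ∀ i, ∀ y ∈ K, ‖iteratedFDeriv ℝ i (h : X → ℂ) y‖ ≤ c * M i) : ‖Δ h‖ ≤ c * ε := by
  -- Rescaling by `d⁻¹` needs `d > 0`, while `c` may be 0; hence `d > c` first, then `d → c`.
  have key : ∀ d > c, ‖Δ h‖ ≤ d * ε := by
    intro d hd
    have hd0 : 0 < d := hc.trans_lt hd
    have := H (((d⁻¹ : ℝ) : ℂ) • h) fun i y hy => by
      have e : iteratedFDeriv ℝ i (((((d⁻¹ : ℝ) : ℂ) • h : SmoothFun X)) : X → ℂ) y =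
          ((d⁻¹ : ℝ) : ℂ) • iteratedFDeriv ℝ i (h : X → ℂ) y :=
        iteratedFDeriv_const_smul_apply
          ((SmoothFun.contDiff h).contDiffAt.of_le (by exact_mod_cast le_top))
      rw [e, norm_smul, Complex.norm_real, Real.norm_eq_abs, abs_of_pos (by positivity)]
      rw [inv_mul_le_iff₀ hd0]
      exact (hh i y hy).trans (mul_le_mul_of_nonneg_right hd.le (hM i))
    rw [map_smul, norm_smul, Complex.norm_real, Real.norm_eq_abs, abs_of_pos (by positivity),
      inv_mul_le_iff₀ hd0] at this
    exact this
  have ht : Tendsto (fun d : ℝ => d * ε) (𝓝[>] c) (𝓝 (c * ε)) :=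
    ((continuous_id.mul continuous_const).tendsto c).mono_left nhdsWithin_le_nhds
  exact ge_of_tendsto ht (eventually_nhdsWithin_of_forall key)

variable {X : Type} [NormedAddCommGroup X] [NormedSpace ℝ X] [FiniteDimensional ℝ X]
  {Λ₁ Λ₂ : SmoothFun X →ₗ[ℂ] ℂ} {K : Set X} {m₁ m₂ : ℕ} {C₁ C₂ : ℝ}

/-- The hypothesis `H` is applied to the translated directional derivatives of `h`, scaled by `c`
and the lengths of the directions. The factor `c` carries the decay in `x` needed for `𝓢`; for `𝓓`
it is 1. -/
theorem norm_iteratedFDeriv_conv_sub_le (hK : IsCompact K) (h₁ : IsBoundedBy Λ₁ K m₁ C₁)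
    (h₂ : IsBoundedBy Λ₂ K m₂ C₂) {M : ℕ → ℝ} (hM : ∀ i, 0 ≤ M i) {ε : ℝ} (hε : 0 ≤ ε)
    (H : ∀ h : SmoothFun X, (∀ i, ∀ y ∈ K, ‖iteratedFDeriv ℝ i (h : X → ℂ) y‖ ≤ M i) →
      ‖Λ₁ h - Λ₂ h‖ ≤ ε)
    {c : ℝ} (hc : 0 ≤ c) {h : SmoothFun X} {j : ℕ} {x : X}
    (hh : ∀ i, ∀ y ∈ K, ‖iteratedFDeriv ℝ (i + j) (h : X → ℂ) (x + y)‖ ≤ c * M i) :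
    ‖iteratedFDeriv ℝ j (conv Λ₁ h - conv Λ₂ h) x‖ ≤ c * ε := by
  have hle : (j : WithTop ℕ∞) ≤ ∞ := by exact_mod_cast le_top
  rw [iteratedFDeriv_sub_apply ((h₁.contDiff_conv hK h).contDiffAt.of_le hle)
    ((h₂.contDiff_conv hK h).contDiffAt.of_le hle)]
  refine ContinuousMultilinearMap.opNorm_le_bound (by positivity) fun v => ?_
  have hv : 0 ≤ ∏ l, ‖v l‖ := Finset.prod_nonneg fun _ _ => norm_nonneg _
  rw [sub_apply, h₁.iteratedFDeriv_conv hK, h₂.iteratedFDeriv_conv hK]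
  have := norm_map_le_of_scaled (Δ := Λ₁ - Λ₂) hM H (c := c * ∏ l, ‖v l‖) (by positivity)
    (h := translate x (dirDeriv v h)) fun i y hy => by
      rw [iteratedFDeriv_translate]
      refine (norm_iteratedFDeriv_dirDeriv_le v h i (x + y)).trans ?_
      calc _ ≤ (∏ l, ‖v l‖) * (c * M i) := by
            gcongr
            exact hh i y hy
        _ = _ := by ring
  calc _ ≤ c * (∏ l, ‖v l‖) * ε := this
    _ = _ := by ring

theorem exists_cutoff_eq_one_near {F : Set X} (hF : IsBounded F) :
    ∃ (K : Compacts X) (χ : SmoothFun X), Function.support (χ : X → ℂ) ⊆ K ∧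
      ∀ ξ : X → ℂ, Disjoint (tsupport fun x => ξ x - (χ : X → ℂ) x * ξ x) F := by
  -- `F` lies in an open ball on which the bump is 1, so even the closure of the support of `ξ - χξ`
  -- misses `F`.
  obtain ⟨R, hR, hFR⟩ := hF.subset_ball_lt 0 0
  let b : ContDiffBump (0 : X) := ⟨R, R + 1, hR, by linarith⟩
  refine ⟨⟨Metric.closedBall 0 (R + 1), isCompact_closedBall _ _⟩,
    ⟨fun x => (b x : ℂ), Complex.ofRealCLM.contDiff.comp b.contDiff⟩, fun x hx => ?_, fun ξ => ?_⟩
  · have hx : b x ≠ 0 := Complex.ofReal_ne_zero.1 hx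
    have : x ∈ Metric.ball (0 : X) b.rOut := by
      rw [← b.support_eq]; exact hx
    exact Metric.ball_subset_closedBall this
  · have : tsupport (fun x => ξ x - (b x : ℂ) * ξ x) ⊆ (Metric.ball (0 : X) R)ᶜ := by
      refine closure_minimal (fun x hx hxR => hx ?_) Metric.isOpen_ball.isClosed_compl
      have : b x = 1 := b.one_of_mem_closedBall (Metric.ball_subset_closedBall hxR)
      simp [this]
    exact Set.disjoint_of_subset_left this (Set.disjoint_compl_left_iff_subset.2 hFR)

end SmoothFun

/-! ### Density of test functions in `𝓢`, with control of supports -/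

namespace SchwartzMap

section Density

variable {X : Type*} [NormedAddCommGroup X] [NormedSpace ℝ X]

/-- Where `σ(a x)` does not vanish locally one has `1 ≤ a‖x‖`, so one extra power of `‖x‖` on `ξ`
buys the factor `a`. -/
theorem seminorm_mul_le_of_scaled {σ : X → ℂ} (hσ : ContDiff ℝ ∞ σ)
    (hσ1 : ∀ x, ‖x‖ < 1 → σ x = 0) {k l : ℕ} {A : ℝ}
    (hA : ∀ j ≤ l, ∀ x, ‖iteratedFDeriv ℝ j σ x‖ ≤ A) {a : ℝ} (ha : 0 < a) (ha1 : a ≤ 1)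
    (ξ φ : 𝓢(X, ℂ)) (hφ : ∀ x, φ x = σ (a • x) * ξ x) :
    SchwartzMap.seminorm ℂ k l φ ≤
      a * (2 ^ l * A * ∑ j ∈ Finset.range (l + 1), SchwartzMap.seminorm ℂ (k + 1) j ξ) := by
  have hA0 : 0 ≤ A := (norm_nonneg _).trans (hA 0 (by omega) 0)
  set P := ∑ j ∈ Finset.range (l + 1), SchwartzMap.seminorm ℂ (k + 1) j ξ with hP
  have hP0 : 0 ≤ P := Finset.sum_nonneg fun _ _ => apply_nonneg _ _
  have hφ' : (φ : X → ℂ) = fun x => σ (a • x) * ξ x := funext hφ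
  refine SchwartzMap.seminorm_le_bound ℂ k l φ (by positivity) fun x => ?_
  rcases lt_or_ge ‖x‖ a⁻¹ with hx | hx
  · have : (φ : X → ℂ) =ᶠ[𝓝 x] 0 := by
      filter_upwards [(isOpen_lt continuous_norm continuous_const).mem_nhds hx] with y hy
      have hy : ‖y‖ < a⁻¹ := hy
      rw [hφ, hσ1, zero_mul]
      · rfl
      · rw [norm_smul, Real.norm_eq_abs, abs_of_pos ha]
        calc a * ‖y‖ < a * a⁻¹ := by gcongr
          _ = 1 := mul_inv_cancel₀ ha.ne'
    rw [(this.iteratedFDeriv ℝ l).eq_of_nhds]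
    change ‖x‖ ^ k * ‖iteratedFDeriv ℝ l (fun _ : X => (0 : ℂ)) x‖ ≤ _
    rw [iteratedFDeriv_fun_zero]
    simp only [Pi.zero_apply, norm_zero, mul_zero]
    positivity
  · have hsc : ContDiff ℝ ∞ fun x : X => σ (a • x) := hσ.comp (contDiff_const_smul a)
    have hxa : 1 ≤ a * ‖x‖ := by
      calc 1 = a * a⁻¹ := (mul_inv_cancel₀ ha.ne').symm
        _ ≤ _ := by gcongr
    have hj (j : ℕ) (hj : j ≤ l) : ‖iteratedFDeriv ℝ j (fun x : X => σ (a • x)) x‖ ≤ A := by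
      rw [iteratedFDeriv_comp_const_smul a (hσ.of_le (by exact_mod_cast le_top)), norm_smul,
        norm_pow, Real.norm_eq_abs, abs_of_pos ha]
      calc _ ≤ 1 * A := by
            gcongr
            · exact pow_le_one₀ ha.le ha1
            · exact hA j hj _
        _ = A := one_mul A
    have hd : ‖x‖ ^ (k + 1) * ‖iteratedFDeriv ℝ l φ x‖ ≤ 2 ^ l * A * P := by
      rw [hφ']
      calc _ ≤ ‖x‖ ^ (k + 1) * ∑ j ∈ Finset.range (l + 1), (l.choose j : ℝ) *
            ‖iteratedFDeriv ℝ j (fun x : X => σ (a • x)) x‖ * ‖iteratedFDeriv ℝ (l - j) ξ x‖ := by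
            gcongr
            exact norm_iteratedFDeriv_mul_le hsc (ξ.smooth ⊤) x (by exact_mod_cast le_top)
        _ = ∑ j ∈ Finset.range (l + 1), (l.choose j : ℝ) *
            ‖iteratedFDeriv ℝ j (fun x : X => σ (a • x)) x‖ *
            (‖x‖ ^ (k + 1) * ‖iteratedFDeriv ℝ (l - j) ξ x‖) := by
            rw [Finset.mul_sum]
            exact Finset.sum_congr rfl fun _ _ => by ring
        _ ≤ ∑ j ∈ Finset.range (l + 1), (l.choose j : ℝ) * A * P := by
            gcongr with j hjl
            · exact hj j (by have := Finset.mem_range.1 hjl; omega)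
            · refine (ξ.le_seminorm ℂ (k + 1) (l - j) x).trans ?_
              exact Finset.single_le_sum (f := fun j => SchwartzMap.seminorm ℂ (k + 1) j ξ)
                (fun _ _ => apply_nonneg _ _) (Finset.mem_range.2 (by omega))
        _ = 2 ^ l * A * P := by
            simp_rw [mul_assoc]
            rw [← Finset.sum_mul, ← Nat.cast_sum, Nat.sum_range_choose]
            push_cast; rfl
    calc ‖x‖ ^ k * ‖iteratedFDeriv ℝ l φ x‖
        = 1 * (‖x‖ ^ k * ‖iteratedFDeriv ℝ l φ x‖) := (one_mul _).symm
      _ ≤ (a * ‖x‖) * (‖x‖ ^ k * ‖iteratedFDeriv ℝ l φ x‖) := by gcongr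
      _ = a * (‖x‖ ^ (k + 1) * ‖iteratedFDeriv ℝ l φ x‖) := by ring
      _ ≤ _ := by gcongr

variable [FiniteDimensional ℝ X]

/-- Every Schwartz function is a limit of test functions supported in its support. -/
theorem exists_testFunction_tendsto (ξ : 𝓢(X, ℂ)) :
    ∃ ψ : ℕ → 𝓓((⊤ : Opens X), ℂ), (∀ R, tsupport (ψ R) ⊆ tsupport ξ) ∧
      Tendsto (fun R => TestFunction.toSchwartzMapLM (ψ R)) atTop (𝓝 ξ) := by
  let θ : ContDiffBump (0 : X) := ⟨1, 2, one_pos, by norm_num⟩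
  let τ : X → ℂ := fun x => (θ x : ℂ)
  have hτ : ContDiff ℝ ∞ τ := Complex.ofRealCLM.contDiff.comp θ.contDiff
  have hτc : HasCompactSupport τ := θ.hasCompactSupport.comp_left (g := ((↑) : ℝ → ℂ)) rfl
  let a (R : ℕ) : ℝ := 1 / ((R : ℝ) + 1)
  have ha (R : ℕ) : 0 < a R := by positivity
  have ha1 (R : ℕ) : a R ≤ 1 := by
    rw [div_le_one (by positivity)]
    linarith [(Nat.cast_nonneg R : (0 : ℝ) ≤ R)]
  let ψ (R : ℕ) : 𝓓((⊤ : Opens X), ℂ) :=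
    { toFun := fun x => τ (a R • x) * ξ x
      contDiff' := (hτ.comp (contDiff_const_smul (a R))).mul (ξ.smooth ⊤)
      hasCompactSupport' := (hτc.comp_smul (ha R).ne').mul_right
      tsupport_subset' := fun _ _ => trivial }
  refine ⟨ψ, fun R => closure_mono fun x hx => right_ne_zero_of_mul hx, ?_⟩
  -- The error `ψ R - ξ` equals `σ(a R • x) ξ(x)`, with `σ` vanishing on the unit ball.
  let σ : X → ℂ := fun x => τ x - 1
  have hσ : ContDiff ℝ ∞ σ := hτ.sub contDiff_const
  have hσ1 : ∀ x, ‖x‖ < 1 → σ x = 0 := fun x hx => by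
    have : θ x = 1 := θ.one_of_mem_closedBall (by simpa using hx.le)
    simp [σ, τ, this]
  have hσb (j : ℕ) : ∃ A, ∀ x, ‖iteratedFDeriv ℝ j σ x‖ ≤ A := by
    have hle : (j : WithTop ℕ∞) ≤ ∞ := by exact_mod_cast le_top
    obtain ⟨A, hA⟩ := Continuous.bounded_above_of_compact_support
      (hτ.continuous_iteratedFDeriv hle) (hτc.iteratedFDeriv j)
    refine ⟨A + 1, fun x => ?_⟩
    have e : iteratedFDeriv ℝ j σ x =
        iteratedFDeriv ℝ j τ x - iteratedFDeriv ℝ j (fun _ : X => (1 : ℂ)) x :=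
      iteratedFDeriv_sub_apply (hτ.contDiffAt.of_le hle) contDiffAt_const
    have h1 : ‖iteratedFDeriv ℝ j (fun _ : X => (1 : ℂ)) x‖ ≤ 1 := by
      rcases Nat.eq_zero_or_pos j with rfl | hj
      · simp
      · rw [iteratedFDeriv_const_of_ne hj.ne']
        simp
    rw [e]
    exact (norm_sub_le _ _).trans (add_le_add (hA x) h1)
  choose A hA using hσb
  rw [(schwartz_withSeminorms ℂ X ℂ).tendsto_nhds]
  rintro ⟨k, l⟩ ε hε
  set D := 2 ^ l * (∑ j ∈ Finset.range (l + 1), |A j|) *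
    ∑ j ∈ Finset.range (l + 1), SchwartzMap.seminorm ℂ (k + 1) j ξ with hD
  have hlim : Tendsto (fun R => a R * D) atTop (𝓝 (0 * D)) :=
    tendsto_one_div_add_atTop_nhds_zero_nat.mul_const D
  rw [zero_mul] at hlim
  filter_upwards [hlim.eventually_lt_const hε] with R hR
  refine lt_of_le_of_lt (seminorm_mul_le_of_scaled hσ hσ1 (fun j hj x => ?_) (ha R) (ha1 R) ξ _
    fun x => ?_) hR
  · exact (hA j x).trans ((le_abs_self _).trans (Finset.single_le_sum (f := fun j => |A j|)
      (fun _ _ => abs_nonneg _) (Finset.mem_range.2 (by omega))))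
  · change τ (a R • x) * ξ x - ξ x = (τ (a R • x) - 1) * ξ x
    ring

/-- The support of `ξ` need not be compact, so a finite partition of unity is available only for its
approximants; these are supported inside that of `ξ`. -/
theorem map_eq_zero_of_disjoint_dsupport (f : 𝓢(X, ℂ) →L[ℂ] ℂ) {ξ : 𝓢(X, ℂ)}
    (h : Disjoint (tsupport ξ) (dsupport f)) : f ξ = 0 := by
  obtain ⟨ψ, hψ, hlim⟩ := exists_testFunction_tendsto ξ
  have h0 (R : ℕ) : f (TestFunction.toSchwartzMapLM (ψ R)) = 0 := by
    refine TestFunction.map_eq_zero_of_locally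
      (f.toLinearMap ∘ₗ TestFunction.toSchwartzMapLM) (ψ R) fun x hx => ?_
    obtain ⟨G, hG, hGo, hxG⟩ := (notMem_dsupport_iff x).1 (h.notMem_of_mem_left (hψ R hx))
    exact ⟨G, hGo, hxG, fun φ hφ => hG (TestFunction.toSchwartzMapLM φ) hφ⟩
  refine tendsto_nhds_unique ((f.continuous.tendsto ξ).comp hlim) ?_
  simp [Function.comp_def, h0]

end Density

end SchwartzMap

/-! ### From convergence of convolution operators to convergence of `f_k ∗ g` -/

section Generic

variable {E : Type*} [AddCommGroup E] [Module ℂ E] [TopologicalSpace E]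
  {X : Type*} [Add X] [FunLike E X ℂ] [TranslationInvariant E]

theorem IsConvolutionMultiplier.of_continuousLinearMap {f : E →L[ℂ] ℂ} {T : E →L[ℂ] E}
    (hT : ∀ ξ, ⇑(T ξ) = convFun f ξ) : IsConvolutionMultiplier f where
  mem ξ := ⟨T ξ, hT ξ⟩
  tendsto_zero ξ η hη hξ := by
    have : η = fun k => T (ξ k) := funext fun k => DFunLike.coe_injective ((hη k).trans (hT _).symm)
    rw [this]
    exact (T.continuous.tendsto' 0 0 (map_zero T)).comp hξ

theorem IsConvolutionMultiplier.conv_eq {f : E →L[ℂ] ℂ} (h : IsConvolutionMultiplier f)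
    {ξ η : E} (hη : ⇑η = convFun f ξ) : h.conv ξ = η :=
  DFunLike.coe_injective ((h.mem ξ).choose_spec.trans hη.symm)

/-- The convergence `f_k ∗ g → f₀ ∗ g` on bounded sets follows from that of `f_k ∗ ξ`. -/
theorem IsConvolutionMultiplier.exists_tendstoUniformlyOn_convFunctional [ContinuousConstSMul ℂ E]
    {f : ℕ → E →L[ℂ] ℂ} {f₀ : E →L[ℂ] ℂ} {T : ℕ → E →L[ℂ] E} {T₀ : E →L[ℂ] E}
    (hT : ∀ k ξ, ⇑(T k ξ) = convFun (f k) ξ) (hT₀ : ∀ ξ, ⇑(T₀ ξ) = convFun f₀ ξ)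
    (hu : ∀ B : Set E, IsVonNBounded ℂ B → ∀ V ∈ 𝓝 (0 : E), ∀ᶠ k in atTop, ∀ ξ ∈ B,
      T k ξ - T₀ ξ ∈ V) :
    ∃ (hf : ∀ k, IsConvolutionMultiplier (f k)) (hf₀ : IsConvolutionMultiplier f₀),
      ∀ γ ∈ CZero, ∀ U ∈ 𝓝 (0 : E), ∀ g ∈ demiSpan γ U,
        ∀ B : Set E, IsVonNBounded ℂ B →
          TendstoUniformlyOn (fun k => (hf k).convFunctional g) (hf₀.convFunctional g) atTop B := by
  refine ⟨fun k => .of_continuousLinearMap (hT k), .of_continuousLinearMap hT₀,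
    fun γ hγ U hU g hg B hB => ?_⟩
  have := tendstoUniformlyOn_of_mem_demiSpan hγ hU hg (hB.image T₀) (hu B hB)
  unfold IsConvolutionMultiplier.convFunctional
  simp_rw [fun k ξ => IsConvolutionMultiplier.conv_eq
    (IsConvolutionMultiplier.of_continuousLinearMap (hT k)) (hT k ξ),
    fun ξ => IsConvolutionMultiplier.conv_eq
    (IsConvolutionMultiplier.of_continuousLinearMap hT₀) (hT₀ ξ)]
  exact this

end Generic

/-- The smooth function underlying a Schwartz function. -/
noncomputable def SchwartzMap.toSmoothFun {X : Type*} [NormedAddCommGroup X] [NormedSpace ℝ X] :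
    𝓢(X, ℂ) →ₗ[ℂ] SmoothFun X where
  toFun ξ := ⟨ξ, ξ.smooth ⊤⟩
  map_add' _ _ := rfl
  map_smul' _ _ := rfl

/-- The inclusion of `𝓓_K` in the Schwartz space. -/
noncomputable def ContDiffMapSupportedIn.toSchwartzMapCLM {X : Type*} [NormedAddCommGroup X]
    [NormedSpace ℝ X] (K : Compacts X) : 𝓓_{K}(X, ℂ) →L[ℂ] 𝓢(X, ℂ) where
  toFun φ := φ.hasCompactSupport.toSchwartzMap φ.contDiff
  map_add' _ _ := rfl
  map_smul' _ _ := rfl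
  cont := by
    let Φ : 𝓓_{K}(X, ℂ) →ₗ[ℂ] 𝓢(X, ℂ) :=
      { toFun := fun φ => φ.hasCompactSupport.toSchwartzMap φ.contDiff
        map_add' := fun _ _ => rfl
        map_smul' := fun _ _ => rfl }
    change Continuous Φ
    obtain ⟨R, hR, hKR⟩ := K.isCompact.isBounded.exists_pos_norm_le
    refine WithSeminorms.continuous_of_isBounded (ContDiffMapSupportedIn.withSeminorms ℂ X ℂ ⊤ K)
      (schwartz_withSeminorms ℂ X ℂ) Φ (.of_real ?_)
    rintro ⟨k, l⟩
    refine ⟨{l}, R ^ k, fun φ => ?_⟩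
    rw [Finset.sup_singleton]
    refine SchwartzMap.seminorm_le_bound ℂ k l _ (by positivity) fun x => ?_
    change ‖x‖ ^ k * ‖iteratedFDeriv ℝ l φ x‖ ≤ R ^ k * ContDiffMapSupportedIn.seminorm ℂ X ℂ ⊤ K l φ
    by_cases hx : x ∈ (K : Set X)
    · gcongr
      · exact hKR x hx
      · exact norm_iteratedFDeriv_apply_le_seminorm_top ℂ
    · rw [φ.iteratedFDeriv_zero_on_compl hx]
      simp only [Pi.zero_apply, norm_zero, mul_zero]
      positivity

/-! ### The case of `𝓢` -/

namespace SchwartzMap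

variable {X : Type} [NormedAddCommGroup X] [NormedSpace ℝ X]

/-- Since `1 + ‖x‖ ≤ (1 + ρ)(1 + ‖x + y‖)`, the Schwartz decay at `x + y` becomes decay in `x`,
uniformly for `y ∈ K`. -/
theorem norm_iteratedFDeriv_add_le {K : Set X} {ρ : ℝ} (hρ : ∀ y ∈ K, ‖y‖ ≤ ρ)
    (ξ : 𝓢(X, ℂ)) {k l i : ℕ} (hi : i ≤ l) (x : X) {y : X} (hy : y ∈ K) :
    ‖iteratedFDeriv ℝ i ξ (x + y)‖ ≤ ((1 + ‖x‖) ^ k)⁻¹ * ((1 + ρ) ^ k *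
      (2 ^ k * (Finset.Iic (k, l)).sup (schwartzSeminormFamily ℂ X ℂ) ξ)) := by
  have hρ0 : 0 ≤ ρ := (norm_nonneg y).trans (hρ y hy)
  have h1 : 1 + ‖x‖ ≤ (1 + ρ) * (1 + ‖x + y‖) := by
    have : ‖x‖ ≤ ‖x + y‖ + ‖y‖ := by simpa using norm_sub_le (x + y) y
    nlinarith [hρ y hy, norm_nonneg (x + y)]
  have h2 := one_add_le_sup_seminorm_apply (𝕜 := ℂ) (m := (k, l)) (k := k) (n := i) le_rfl hi
    ξ (x + y)
  rw [le_inv_mul_iff₀ (by positivity)]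
  calc _ ≤ ((1 + ρ) * (1 + ‖x + y‖)) ^ k * ‖iteratedFDeriv ℝ i ξ (x + y)‖ := by gcongr
    _ = (1 + ρ) ^ k * ((1 + ‖x + y‖) ^ k * ‖iteratedFDeriv ℝ i ξ (x + y)‖) := by
        rw [mul_pow]; ring
    _ ≤ _ := mul_le_mul_of_nonneg_left h2 (by positivity)

theorem norm_pow_mul_inv_le {X : Type*} [NormedAddCommGroup X] {k : ℕ} (x : X) : ‖x‖ ^ k * ((1 + ‖x‖) ^ k)⁻¹ ≤ 1 := by
  rw [← div_eq_mul_inv, div_le_one (by positivity)]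
  gcongr
  linarith

variable [FiniteDimensional ℝ X]

/-- Convolution with a compactly supported functional of finite order, on the Schwartz space. -/
noncomputable def convCLM (Λ : SmoothFun X →ₗ[ℂ] ℂ) {K : Set X} (hK : IsCompact K) {m : ℕ} {C : ℝ}
    (hΛ : SmoothFun.IsBoundedBy Λ K m C) : 𝓢(X, ℂ) →L[ℂ] 𝓢(X, ℂ) :=
  SchwartzMap.mkCLM (fun ξ => SmoothFun.conv Λ (toSmoothFun ξ))
    (fun ξ η x => by rw [map_add, SmoothFun.conv_add]; rfl)
    (fun c ξ x => by rw [map_smul, SmoothFun.conv_smul]; rfl)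
    (fun ξ => hΛ.contDiff_conv hK _)
    (by
      rintro ⟨k, j⟩
      obtain ⟨ρ, hρ0, hρ⟩ := hK.isBounded.exists_pos_norm_le
      have hC := hΛ.1
      refine ⟨Finset.Iic (k, m + j), C * ((1 + ρ) ^ k * 2 ^ k), by positivity, fun ξ x => ?_⟩
      have := hΛ.norm_iteratedFDeriv_conv_le hK (toSmoothFun ξ) j x (by positivity)
        fun i hi y hy => norm_iteratedFDeriv_add_le hρ ξ (k := k) hi x hy
      set S := (Finset.Iic (k, m + j)).sup (schwartzSeminormFamily ℂ X ℂ) ξ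
      have hS : 0 ≤ S := apply_nonneg _ _
      calc _ ≤ ‖x‖ ^ k * (C * (((1 + ‖x‖) ^ k)⁻¹ * ((1 + ρ) ^ k * (2 ^ k * S)))) := by gcongr
        _ = (‖x‖ ^ k * ((1 + ‖x‖) ^ k)⁻¹) * (C * ((1 + ρ) ^ k * 2 ^ k) * S) := by ring
        _ ≤ 1 * (C * ((1 + ρ) ^ k * 2 ^ k) * S) := by
            gcongr
            exact norm_pow_mul_inv_le x
        _ = _ := one_mul _)

/-- A functional of finite order, on the Schwartz space. -/
noncomputable def ofSmoothFunCLM (Λ : SmoothFun X →ₗ[ℂ] ℂ) {K : Set X}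
    {m : ℕ} {C : ℝ} (hΛ : SmoothFun.IsBoundedBy Λ K m C) : 𝓢(X, ℂ) →L[ℂ] ℂ :=
  SchwartzMap.mkCLMtoNormedSpace (fun ξ => Λ (toSmoothFun ξ)) (fun ξ η => by simp)
    (fun c ξ => by simp)
    (by
      refine ⟨Finset.Iic (0, m), C, hΛ.1, fun ξ => hΛ.2 _ _ (apply_nonneg _ _) fun i hi y _ => ?_⟩
      have := one_add_le_sup_seminorm_apply (𝕜 := ℂ) (m := (0, m)) (k := 0) (n := i) le_rfl hi ξ y
      simp only [pow_zero, one_mul] at this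
      exact this)

theorem eventually_convCLM_sub_mem {K : Set X} (hK : IsCompact K) {Λ : ℕ → SmoothFun X →ₗ[ℂ] ℂ}
    {Λ₀ : SmoothFun X →ₗ[ℂ] ℂ} {m : ℕ → ℕ} {C : ℕ → ℝ}
    (hΛ : ∀ k, SmoothFun.IsBoundedBy (Λ k) K (m k) (C k)) {m₀ : ℕ} {C₀ : ℝ}
    (hΛ₀ : SmoothFun.IsBoundedBy Λ₀ K m₀ C₀)
    (hu : ∀ M : ℕ → ℝ, ∀ ε > 0, ∀ᶠ k in atTop,
      ∀ h : SmoothFun X, (∀ i, ∀ y ∈ K, ‖iteratedFDeriv ℝ i (h : X → ℂ) y‖ ≤ M i) →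
        ‖Λ k h - Λ₀ h‖ ≤ ε)
    {B : Set 𝓢(X, ℂ)} (hB : IsVonNBounded ℂ B) {V : Set 𝓢(X, ℂ)} (hV : V ∈ 𝓝 0) :
    ∀ᶠ k in atTop, ∀ ξ ∈ B, convCLM (Λ k) hK (hΛ k) ξ - convCLM Λ₀ hK hΛ₀ ξ ∈ V := by
  obtain ⟨s, r, hr, hsV⟩ := ((schwartz_withSeminorms ℂ X ℂ).mem_nhds_iff 0 V).1 hV
  obtain ⟨ρ, hρ0, hρ⟩ := hK.isBounded.exists_pos_norm_le
  have hbd := (schwartz_withSeminorms ℂ X ℂ).isVonNBounded_iff_finset_seminorm_bounded.1 hB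
  have key : ∀ p ∈ s, ∀ᶠ k in atTop, ∀ ξ ∈ B,
      schwartzSeminormFamily ℂ X ℂ p (convCLM (Λ k) hK (hΛ k) ξ - convCLM Λ₀ hK hΛ₀ ξ) ≤ r / 2 := by
    rintro ⟨a, j⟩ -
    -- One bound on `B` for each order `i`. All orders are required, because the orders `m k` are
    -- not assumed bounded in `k`.
    choose Q hQ0 hQ using fun i => hbd (Finset.Iic (a, i + j))
    filter_upwards [hu (fun i => (1 + ρ) ^ a * (2 ^ a * Q i)) (r / 2) (by positivity)] with
      k hk ξ hξ
    refine SchwartzMap.seminorm_le_bound ℂ a j _ (by positivity) fun x => ?_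
    have := SmoothFun.norm_iteratedFDeriv_conv_sub_le hK (hΛ k) hΛ₀
      (fun i => by have := hQ0 i; positivity) (by positivity) hk
      (c := ((1 + ‖x‖) ^ a)⁻¹) (by positivity) (h := toSmoothFun ξ) (j := j) (x := x)
      fun i y hy => (norm_iteratedFDeriv_add_le hρ ξ (k := a) le_rfl x hy).trans (by
        gcongr
        exact (hQ i ξ hξ).le)
    calc ‖x‖ ^ a * ‖iteratedFDeriv ℝ j (SmoothFun.conv (Λ k) (toSmoothFun ξ) -
            SmoothFun.conv Λ₀ (toSmoothFun ξ)) x‖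
        ≤ ‖x‖ ^ a * (((1 + ‖x‖) ^ a)⁻¹ * (r / 2)) := by gcongr
      _ = (‖x‖ ^ a * ((1 + ‖x‖) ^ a)⁻¹) * (r / 2) := by ring
      _ ≤ 1 * (r / 2) := by
          gcongr
          exact norm_pow_mul_inv_le x
      _ = _ := one_mul _
  filter_upwards [(eventually_all_finset s).2 key] with k hk ξ hξ
  refine hsV ?_
  rw [Seminorm.mem_ball_zero]
  exact (Seminorm.finset_sup_apply_le (by positivity) fun p hp => hk p hp ξ hξ).trans_lt
    (by linarith)


theorem exists_tendstoUniformlyOn_convFunctional (n : ℕ) (f : ℕ → TestS n →L[ℂ] ℂ)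
    (f_lim : TestS n → ℂ) (hlim : ∀ ξ : TestS n, Tendsto (fun k => f k ξ) atTop (𝓝 (f_lim ξ)))
    (hsupp : ∃ F : Set (EuclideanSpace ℝ (Fin n)), Bornology.IsBounded F ∧
      ∀ k, dsupport (f k) ⊆ F) :
    ∃ f₀ : TestS n →L[ℂ] ℂ, ⇑f₀ = f_lim ∧
      ∃ (hf : ∀ k, IsConvolutionMultiplier (f k)) (hf₀ : IsConvolutionMultiplier f₀),
        ∀ γ ∈ CZero, ∀ U ∈ 𝓝 (0 : TestS n), ∀ g ∈ demiSpan γ U,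
          ∀ B : Set (TestS n), IsVonNBounded ℂ B →
            TendstoUniformlyOn (fun k => (hf k).convFunctional g) (hf₀.convFunctional g)
              atTop B := by
  obtain ⟨F, hF, hfF⟩ := hsupp
  obtain ⟨K, χ, hχ, hχF⟩ := SmoothFun.exists_cutoff_eq_one_near hF
  let j := ContDiffMapSupportedIn.toSchwartzMapCLM K
  let L (k : ℕ) : 𝓓_{K}(EuclideanSpace ℝ (Fin n), ℂ) →L[ℂ] ℂ := (f k).comp j
  obtain ⟨L₀, hL₀, hu⟩ := SmoothFun.exists_limit_uniform_of_tendsto hχ (L := L)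
    (ℓ := fun φ => f_lim (j φ)) fun φ => hlim (j φ)
  choose m C hΛ using fun k => SmoothFun.exists_isBoundedBy_comp_cutoff hχ (L k)
  obtain ⟨m₀, C₀, hΛ₀⟩ := SmoothFun.exists_isBoundedBy_comp_cutoff hχ L₀
  -- The support of `ξ - χξ` misses `F`, hence that of `f k`.
  have hfk (k : ℕ) (ξ : TestS n) : f k ξ = L k (SmoothFun.cutoff χ hχ (toSmoothFun ξ)) := by
    rw [← sub_eq_zero]
    change f k ξ - f k (j (SmoothFun.cutoff χ hχ (toSmoothFun ξ))) = 0
    rw [← map_sub]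
    exact map_eq_zero_of_disjoint_dsupport (f k) (Set.disjoint_of_subset_right (hfF k) (hχF ξ))
  have hf₀ (ξ : TestS n) : f_lim ξ = L₀ (SmoothFun.cutoff χ hχ (toSmoothFun ξ)) := by
    refine tendsto_nhds_unique (hlim ξ) ?_
    simp_rw [hfk, hL₀]
    exact hlim _
  -- Defining the limit through `L₀` and the cutoff gives its continuity on `𝓢` directly.
  let f₀ : TestS n →L[ℂ] ℂ := ofSmoothFunCLM _ hΛ₀
  have hf₀' (ξ : TestS n) : f₀ ξ = L₀ (SmoothFun.cutoff χ hχ (toSmoothFun ξ)) := rfl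
  have htr (ξ : TestS n) (x : EuclideanSpace ℝ (Fin n)) :
      toSmoothFun (TranslationInvariant.translate x ξ) =
        SmoothFun.translate x (toSmoothFun ξ) :=
    Subtype.ext (funext (TranslationInvariant.translate_apply x ξ))
  refine ⟨f₀, funext fun ξ => (hf₀ ξ).symm, ?_⟩
  refine IsConvolutionMultiplier.exists_tendstoUniformlyOn_convFunctional
    (T := fun k => convCLM _ K.isCompact (hΛ k)) (T₀ := convCLM _ K.isCompact hΛ₀)
    (fun k ξ => funext fun x => ?_) (fun ξ => funext fun x => ?_)
    fun B hB V hV => eventually_convCLM_sub_mem K.isCompact hΛ hΛ₀ hu hB hV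
  · rw [convFun, hfk, htr]
    rfl
  · rw [convFun, hf₀', htr]
    rfl

end SchwartzMap

/-! ### Supports of convolutions, and convolution on `𝓓_K` -/

section

open scoped Pointwise

/-- If `x + K` misses `S`, all derivatives of `h` vanish on `x + K`, and the bound on `Λ` applies
with `M = 0`. -/
theorem SmoothFun.IsBoundedBy.support_conv_subset {X : Type*} [NormedAddCommGroup X]
    [NormedSpace ℝ X] {Λ : SmoothFun X →ₗ[ℂ] ℂ} {K S : Set X} {m : ℕ} {C : ℝ}
    (hΛ : IsBoundedBy Λ K m C) (h : SmoothFun X) (hS : tsupport (h : X → ℂ) ⊆ S) :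
    Function.support (conv Λ h) ⊆ S - K := by
  intro x hx
  by_contra hxS
  refine hx (norm_le_zero_iff.1 ((hΛ.2 (translate x h) 0 le_rfl fun i _ y hy => ?_).trans
    (mul_zero C).le))
  rw [iteratedFDeriv_translate]
  have : iteratedFDeriv ℝ i (h : X → ℂ) (x + y) = 0 := by
    by_contra hne
    exact hxS ⟨x + y, hS (support_iteratedFDeriv_subset i hne), y, hy, add_sub_cancel_right x y⟩
  rw [this, norm_zero]

/-- The difference of two compact sets. -/
def TopologicalSpace.Compacts.diff {X : Type*} [NormedAddCommGroup X] (K₁ K₂ : Compacts X) :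
    Compacts X :=
  ⟨(K₁ : Set X) - K₂, by
    rw [← Set.sub_image_prod]
    exact (K₁.isCompact.prod K₂.isCompact).image continuous_sub⟩

end

/-- The smooth function underlying an element of `𝓓_K`. -/
noncomputable def ContDiffMapSupportedIn.toSmoothFun {X : Type*} [NormedAddCommGroup X]
    [NormedSpace ℝ X] {K : Compacts X} : 𝓓_{K}(X, ℂ) →ₗ[ℂ] SmoothFun X where
  toFun ξ := ⟨ξ, ξ.contDiff⟩
  map_add' _ _ := rfl
  map_smul' _ _ := rfl

namespace ContDiffMapSupportedIn

variable {X : Type} [NormedAddCommGroup X] [NormedSpace ℝ X] {K₁ K : Compacts X}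
  {Λ : SmoothFun X →ₗ[ℂ] ℂ} {m : ℕ} {C : ℝ}

theorem norm_iteratedFDeriv_le_sup (φ : 𝓓_{K₁}(X, ℂ)) {i l : ℕ} (hi : i ≤ l) (x : X) :
    ‖iteratedFDeriv ℝ i φ x‖ ≤
      ((Finset.range (l + 1)).sup fun j => ContDiffMapSupportedIn.seminorm ℂ X ℂ ⊤ K₁ j) φ :=
  (norm_iteratedFDeriv_apply_le_seminorm_top ℂ).trans
    (Seminorm.le_finset_sup_apply (Finset.mem_range.2 (by omega)))

/-- A functional of finite order, on `𝓓_K`. -/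
noncomputable def ofSmoothFunCLM (K₁ : Compacts X) {K : Set X} (hΛ : SmoothFun.IsBoundedBy Λ K m C) :
    𝓓_{K₁}(X, ℂ) →L[ℂ] ℂ :=
  ContDiffMapSupportedIn.mkCLMtoNormedSpace ℂ (fun φ => Λ (toSmoothFun φ)) (fun φ ψ => by simp)
    (fun c φ => by simp)
    ⟨Finset.range (m + 1), C, hΛ.1, fun φ => hΛ.2 _ _ (apply_nonneg _ _)
      fun _ hi y _ => norm_iteratedFDeriv_le_sup φ hi y⟩

/-- Convolution with a compactly supported functional of finite order, on `𝓓_{K₁}`. -/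
noncomputable def convCLM [FiniteDimensional ℝ X] (K₁ : Compacts X)
    (hΛ : SmoothFun.IsBoundedBy Λ (K : Set X) m C) :
    𝓓_{K₁}(X, ℂ) →L[ℂ] 𝓓_{K₁.diff K}(X, ℂ) :=
  ContDiffMapSupportedIn.mkCLM ℂ (fun φ => SmoothFun.conv Λ (toSmoothFun φ))
    (fun φ ψ x => by rw [map_add, SmoothFun.conv_add]; rfl)
    (fun c φ x => by rw [map_smul, SmoothFun.conv_smul]; rfl)
    (fun φ => hΛ.contDiff_conv K.isCompact _)
    (fun φ => Function.support_subset_iff'.1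
      (hΛ.support_conv_subset (toSmoothFun φ) φ.tsupport_subset))
    fun i _ => ⟨Finset.range (m + i + 1), C, hΛ.1, fun φ x _ =>
      hΛ.norm_iteratedFDeriv_conv_le K.isCompact (toSmoothFun φ) i x (apply_nonneg _ _)
        fun _ hl y _ => norm_iteratedFDeriv_le_sup φ hl (x + y)⟩

end ContDiffMapSupportedIn

/-! ### The case of `𝓓`: bounded sets and convolution -/

namespace TestFunction

section

variable {X : Type*} [NormedAddCommGroup X] [NormedSpace ℝ X]

/-- The smooth function underlying a test function. -/
noncomputable def toSmoothFun : 𝓓((⊤ : Opens X), ℂ) →ₗ[ℂ] SmoothFun X where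
  toFun ξ := ⟨ξ, ξ.contDiff⟩
  map_add' _ _ := rfl
  map_smul' _ _ := rfl

/-- The inclusion of test functions in the Schwartz space. -/
noncomputable def toSchwartzMapCLM : 𝓓((⊤ : Opens X), ℂ) →L[ℂ] 𝓢(X, ℂ) :=
  TestFunction.limitCLM ℂ (fun ψ => ψ.hasCompactSupport.toSchwartzMap ψ.contDiff)
    (fun K _ => ContDiffMapSupportedIn.toSchwartzMapCLM K) fun _ _ _ => rfl

/-- The inclusion in `𝓢` is continuous, so it preserves boundedness, and the unweighted Schwartz
seminorms are the suprema sought. -/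
theorem exists_norm_iteratedFDeriv_le_of_isVonNBounded {B : Set 𝓓((⊤ : Opens X), ℂ)}
    (hB : IsVonNBounded ℂ B) :
    ∃ M : ℕ → ℝ, (∀ i, 0 ≤ M i) ∧ ∀ ξ ∈ B, ∀ i x, ‖iteratedFDeriv ℝ i ξ x‖ ≤ M i := by
  have := (schwartz_withSeminorms ℂ X ℂ).isVonNBounded_iff_seminorm_bounded.1
    (hB.image toSchwartzMapCLM)
  choose M hM0 hM using fun i => this (0, i)
  refine ⟨M, fun i => (hM0 i).le, fun ξ hξ i x => ?_⟩
  exact (SchwartzMap.norm_iteratedFDeriv_le_seminorm ℂ (toSchwartzMapCLM ξ) i x).trans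
    (hM i _ ⟨ξ, hξ, rfl⟩).le

instance : ContinuousConstSMul ℂ 𝓓((⊤ : Opens X), ℂ) where
  continuous_const_smul c :=
    (TestFunction.postcompCLM (c • ContinuousLinearMap.id ℂ ℂ) :
      𝓓((⊤ : Opens X), ℂ) →L[ℂ] 𝓓((⊤ : Opens X), ℂ)).continuous

/-- Sampling along a sequence that tends to infinity, with arbitrary weights, is continuous. -/
theorem exists_weighted_sampling (x : ℕ → X) (hx : ∀ j : ℕ, (j : ℝ) ≤ ‖x j‖) (c : ℕ → ℂ) :
    ∃ A : 𝓓((⊤ : Opens X), ℂ) →L[ℂ] BoundedContinuousFunction ℕ ℂ,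
      ∀ ξ j, A ξ j = c j * ξ (x j) := by
  -- Only finitely many sample points lie in `K`, so arbitrary weights cost a finite constant.
  have key (K : Compacts X) : ∃ D : ℝ, 0 ≤ D ∧ ∀ ξ : X → ℂ, (∀ y ∉ K, ξ y = 0) → ∀ b,
      (∀ y, ‖ξ y‖ ≤ b) → ∀ j, ‖c j * ξ (x j)‖ ≤ D * b := by
    obtain ⟨R, hR⟩ := K.isCompact.isBounded.exists_norm_le
    obtain ⟨N, hN⟩ := exists_nat_gt R
    refine ⟨∑ j ∈ Finset.range N, ‖c j‖, Finset.sum_nonneg fun _ _ => norm_nonneg _,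
      fun ξ hξ b hb j => ?_⟩
    have hb0 : 0 ≤ b := (norm_nonneg _).trans (hb 0)
    by_cases hj : j < N
    · rw [norm_mul]
      gcongr
      · exact Finset.single_le_sum (f := fun j => ‖c j‖) (fun _ _ => norm_nonneg _)
          (Finset.mem_range.2 hj)
      · exact hb _
    · rw [hξ _ fun hK => ?_, mul_zero, norm_zero]
      · exact mul_nonneg (Finset.sum_nonneg fun _ _ => norm_nonneg _) hb0
      · have h1 : (N : ℝ) ≤ j := by exact_mod_cast not_lt.1 hj
        linarith [hR _ hK, hx j]
  have hbdd (ξ : 𝓓((⊤ : Opens X), ℂ)) : ∃ D, ∀ j, ‖c j * ξ (x j)‖ ≤ D := by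
    obtain ⟨b, hb⟩ := ξ.continuous.bounded_above_of_compact_support ξ.hasCompactSupport
    obtain ⟨D, -, hD⟩ := key ⟨tsupport ξ, ξ.hasCompactSupport⟩
    exact ⟨_, hD ξ (fun y hy => image_eq_zero_of_notMem_tsupport hy) b hb⟩
  choose D hD using hbdd
  let A (ξ : 𝓓((⊤ : Opens X), ℂ)) : BoundedContinuousFunction ℕ ℂ :=
    BoundedContinuousFunction.ofNormedAddCommGroupDiscrete (fun j => c j * ξ (x j)) (D ξ) (hD ξ)
  refine ⟨TestFunction.mkCLM ℂ A (fun ξ η => ?_) (fun a ξ => ?_) fun K hK => ?_, fun ξ j => rfl⟩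
  · ext j
    exact mul_add (c j) (ξ (x j)) (η (x j))
  · ext j
    exact mul_left_comm (c j) a (ξ (x j))
  · obtain ⟨D, hD0, hD⟩ := key K
    refine (ContDiffMapSupportedIn.mkCLMtoNormedSpace ℂ
      (fun φ : 𝓓_{K}(X, ℂ) => A (ofSupportedIn hK φ)) (fun φ ψ => ?_) (fun a φ => ?_)
      ⟨{0}, D, hD0, fun φ => ?_⟩).continuous
    · ext j
      exact mul_add (c j) (φ (x j)) (ψ (x j))
    · ext j
      exact mul_left_comm (c j) a (φ (x j))
    · rw [Finset.sup_singleton]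
      refine (BoundedContinuousFunction.norm_le (by positivity)).2 fun j => ?_
      exact hD φ (fun y hy => φ.zero_on_compl hy) _
        (fun y => ContDiffMapSupportedIn.norm_apply_le_seminorm ℂ) j

/-- A bounded set of test functions is supported in a common compact set. -/
theorem exists_tsupport_subset_of_isVonNBounded [FiniteDimensional ℝ X]
    {B : Set 𝓓((⊤ : Opens X), ℂ)} (hB : IsVonNBounded ℂ B) :
    ∃ K : Compacts X, ∀ ξ ∈ B, tsupport ξ ⊆ K := by
  by_contra! hcon
  have h (j : ℕ) : ∃ ξ ∈ B, ∃ x : X, (j : ℝ) ≤ ‖x‖ ∧ ξ x ≠ 0 := by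
    obtain ⟨ξ, hξ, hs⟩ := hcon ⟨Metric.closedBall 0 j, isCompact_closedBall _ _⟩
    refine ⟨ξ, hξ, ?_⟩
    by_contra! hx
    refine hs (closure_minimal (fun x hxs => ?_) Metric.isClosed_closedBall)
    change x ∈ Metric.closedBall (0 : X) (j : ℝ)
    rw [mem_closedBall_zero_iff]
    by_contra! hlt
    exact hxs (hx x hlt.le)
  choose ξ hξB x hx hne using h
  -- The weights make the `j`-th entry of `A (ξ j)` equal to `j`, so `A` is unbounded on `B`,
  -- although continuous linear maps preserve boundedness.
  obtain ⟨A, hA⟩ := exists_weighted_sampling x hx fun j => j / ξ j (x j)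
  obtain ⟨r, hr⟩ := (NormedSpace.isVonNBounded_iff' ℂ).1 (hB.image A)
  obtain ⟨N, hN⟩ := exists_nat_gt r
  have h1 := ((A (ξ N)).norm_coe_le_norm N).trans (hr _ ⟨ξ N, hξB N, rfl⟩)
  rw [hA, div_mul_cancel₀ _ (hne N), Complex.norm_natCast] at h1
  linarith

/-- A functional of finite order, on test functions. -/
noncomputable def ofSmoothFunCLM {X : Type} [NormedAddCommGroup X] [NormedSpace ℝ X]
    {Λ : SmoothFun X →ₗ[ℂ] ℂ} {K : Set X} {m : ℕ} {C : ℝ} (hΛ : SmoothFun.IsBoundedBy Λ K m C) :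
    𝓓((⊤ : Opens X), ℂ) →L[ℂ] ℂ :=
  TestFunction.limitCLM ℂ (fun ξ => Λ (toSmoothFun ξ))
    (fun K₁ _ => ContDiffMapSupportedIn.ofSmoothFunCLM K₁ hΛ) fun _ _ _ => rfl

end

variable {X : Type} [NormedAddCommGroup X] [NormedSpace ℝ X] [FiniteDimensional ℝ X]

/-- Convolution with a compactly supported functional of finite order, on test functions. -/
noncomputable def convCLM {Λ : SmoothFun X →ₗ[ℂ] ℂ} {K : Compacts X} {m : ℕ} {C : ℝ}
    (hΛ : SmoothFun.IsBoundedBy Λ (K : Set X) m C) :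
    𝓓((⊤ : Opens X), ℂ) →L[ℂ] 𝓓((⊤ : Opens X), ℂ) :=
  TestFunction.limitCLM ℂ
    (fun ξ =>
      { toFun := SmoothFun.conv Λ (toSmoothFun ξ)
        contDiff' := hΛ.contDiff_conv K.isCompact _
        hasCompactSupport' :=
          HasCompactSupport.intro (K := Compacts.diff ⟨tsupport ξ, ξ.hasCompactSupport⟩ K)
            (Compacts.isCompact _) fun _ hx => by
              by_contra hne
              exact hx (hΛ.support_conv_subset (toSmoothFun ξ) subset_rfl hne)
        tsupport_subset' := fun _ _ => trivial })
    (fun K₁ _ => (ofSupportedInCLM ℂ (Ω := ⊤) (K := K₁.diff K) fun _ _ => trivial).comp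
      (ContDiffMapSupportedIn.convCLM K₁ hΛ)) fun _ _ _ => rfl

/-- All of `B` lies in one `𝓓_{K₁}`, so the differences lie in `𝓓_{K₁ - K}`. Pulling `V` back there
replaces the (LF) topology by explicit seminorms. -/
theorem eventually_convCLM_sub_mem {K : Compacts X} {Λ : ℕ → SmoothFun X →ₗ[ℂ] ℂ}
    {Λ₀ : SmoothFun X →ₗ[ℂ] ℂ} {m : ℕ → ℕ} {C : ℕ → ℝ}
    (hΛ : ∀ k, SmoothFun.IsBoundedBy (Λ k) (K : Set X) (m k) (C k)) {m₀ : ℕ} {C₀ : ℝ}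
    (hΛ₀ : SmoothFun.IsBoundedBy Λ₀ (K : Set X) m₀ C₀)
    (hu : ∀ M : ℕ → ℝ, ∀ ε > 0, ∀ᶠ k in atTop,
      ∀ h : SmoothFun X, (∀ i, ∀ y ∈ K, ‖iteratedFDeriv ℝ i (h : X → ℂ) y‖ ≤ M i) →
        ‖Λ k h - Λ₀ h‖ ≤ ε)
    {B : Set 𝓓((⊤ : Opens X), ℂ)} (hB : IsVonNBounded ℂ B) {V : Set 𝓓((⊤ : Opens X), ℂ)}
    (hV : V ∈ 𝓝 0) :
    ∀ᶠ k in atTop, ∀ ξ ∈ B, convCLM (hΛ k) ξ - convCLM hΛ₀ ξ ∈ V := by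
  obtain ⟨K₁, hK₁⟩ := exists_tsupport_subset_of_isVonNBounded hB
  obtain ⟨M, hM0, hM⟩ := exists_norm_iteratedFDeriv_le_of_isVonNBounded hB
  let J := ofSupportedInCLM ℂ (n := ⊤) (F := ℂ) (Ω := (⊤ : Opens X)) (K := K₁.diff K)
    fun _ _ => trivial
  have hJV : J ⁻¹' V ∈ 𝓝 0 := (J.continuous.tendsto' 0 0 (map_zero J)) hV
  obtain ⟨s, r, hr, hsV⟩ :=
    ((ContDiffMapSupportedIn.withSeminorms ℂ X ℂ ⊤ (K₁.diff K)).mem_nhds_iff 0 _).1 hJV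
  have key : ∀ j ∈ s, ∀ᶠ k in atTop, ∀ ξ ∈ B, ∀ x,
      ‖iteratedFDeriv ℝ j (SmoothFun.conv (Λ k) (toSmoothFun ξ) -
        SmoothFun.conv Λ₀ (toSmoothFun ξ)) x‖ ≤ r / 2 := by
    intro j _
    filter_upwards [hu (fun i => M (i + j)) (r / 2) (by positivity)] with k hk ξ hξ x
    have := SmoothFun.norm_iteratedFDeriv_conv_sub_le K.isCompact (hΛ k) hΛ₀
      (fun i => hM0 (i + j)) (by positivity) hk zero_le_one (h := toSmoothFun ξ) (j := j) (x := x)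
      fun i y _ => (hM ξ hξ (i + j) (x + y)).trans (one_mul _).ge
    rwa [one_mul] at this
  filter_upwards [(eventually_all_finset s).2 key] with k hk ξ hξ
  let φ : 𝓓_{K₁}(X, ℂ) := .of_support_subset ξ.contDiff (subset_closure.trans (hK₁ ξ hξ))
  let ψ := ContDiffMapSupportedIn.convCLM K₁ (hΛ k) φ - ContDiffMapSupportedIn.convCLM K₁ hΛ₀ φ
  have hψ : ψ ∈ J ⁻¹' V := by
    refine hsV ?_
    rw [Seminorm.mem_ball_zero]
    refine (Seminorm.finset_sup_apply_le (a := r / 2) (by positivity) fun j hj => ?_).trans_lt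
      (by linarith)
    rw [ContDiffMapSupportedIn.seminorm_top_le_iff ℂ (by positivity)]
    exact fun x _ => hk j hj ξ hξ x
  -- `J ψ` and the difference of convolutions have the same underlying function, by definition.
  exact hψ

theorem exists_tendstoUniformlyOn_convFunctional (n : ℕ) (f : ℕ → TestD n →L[ℂ] ℂ)
    (f_lim : TestD n → ℂ) (hlim : ∀ ξ : TestD n, Tendsto (fun k => f k ξ) atTop (𝓝 (f_lim ξ)))
    (hsupp : ∃ F : Set (EuclideanSpace ℝ (Fin n)), Bornology.IsBounded F ∧
      ∀ k, dsupport (f k) ⊆ F) :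
    ∃ f₀ : TestD n →L[ℂ] ℂ, ⇑f₀ = f_lim ∧
      ∃ (hf : ∀ k, IsConvolutionMultiplier (f k)) (hf₀ : IsConvolutionMultiplier f₀),
        ∀ γ ∈ CZero, ∀ U ∈ 𝓝 (0 : TestD n), ∀ g ∈ demiSpan γ U,
          ∀ B : Set (TestD n), IsVonNBounded ℂ B →
            TendstoUniformlyOn (fun k => (hf k).convFunctional g) (hf₀.convFunctional g)
              atTop B := by
  obtain ⟨F, hF, hfF⟩ := hsupp
  obtain ⟨K, χ, hχ, hχF⟩ := SmoothFun.exists_cutoff_eq_one_near hF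
  let j := ofSupportedInCLM ℂ (n := ⊤) (F := ℂ)
    (Ω := (⊤ : Opens (EuclideanSpace ℝ (Fin n)))) (K := K) fun _ _ => trivial
  let L (k : ℕ) : 𝓓_{K}(EuclideanSpace ℝ (Fin n), ℂ) →L[ℂ] ℂ := (f k).comp j
  obtain ⟨L₀, hL₀, hu⟩ := SmoothFun.exists_limit_uniform_of_tendsto hχ (L := L)
    (ℓ := fun φ => f_lim (j φ)) fun φ => hlim (j φ)
  choose m C hΛ using fun k => SmoothFun.exists_isBoundedBy_comp_cutoff hχ (L k)
  obtain ⟨m₀, C₀, hΛ₀⟩ := SmoothFun.exists_isBoundedBy_comp_cutoff hχ L₀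
  have hfk (k : ℕ) (ξ : TestD n) : f k ξ = L k (SmoothFun.cutoff χ hχ (toSmoothFun ξ)) := by
    rw [← sub_eq_zero]
    change f k ξ - f k (j (SmoothFun.cutoff χ hχ (toSmoothFun ξ))) = 0
    rw [← map_sub]
    exact map_eq_zero_of_disjoint_dsupport (f k) (Set.disjoint_of_subset_right (hfF k) (hχF ξ))
  have hf₀ (ξ : TestD n) : f_lim ξ = L₀ (SmoothFun.cutoff χ hχ (toSmoothFun ξ)) := by
    refine tendsto_nhds_unique (hlim ξ) ?_
    simp_rw [hfk, hL₀]
    exact hlim _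
  let f₀ : TestD n →L[ℂ] ℂ := ofSmoothFunCLM hΛ₀
  have hf₀' (ξ : TestD n) : f₀ ξ = L₀ (SmoothFun.cutoff χ hχ (toSmoothFun ξ)) := rfl
  have htr (ξ : TestD n) (x : EuclideanSpace ℝ (Fin n)) :
      toSmoothFun (TranslationInvariant.translate x ξ) =
        SmoothFun.translate x (toSmoothFun ξ) :=
    Subtype.ext (funext (TranslationInvariant.translate_apply x ξ))
  refine ⟨f₀, funext fun ξ => (hf₀ ξ).symm, ?_⟩
  refine IsConvolutionMultiplier.exists_tendstoUniformlyOn_convFunctional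
    (T := fun k => convCLM (hΛ k)) (T₀ := convCLM hΛ₀)
    (fun k ξ => funext fun x => ?_) (fun ξ => funext fun x => ?_)
    fun B hB V hV => eventually_convCLM_sub_mem hΛ hΛ₀ hu hB hV
  · rw [convFun, hfk, htr]
    rfl
  · rw [convFun, hf₀', htr]
    rfl

end TestFunction

theorem theorem4p4 (n : ℕ) :
    -- the case `E = 𝓓`
    (∀ (f : ℕ → TestD n →L[ℂ] ℂ) (f_lim : TestD n → ℂ),
      (∀ ξ : TestD n, Tendsto (fun k => f k ξ) atTop (𝓝 (f_lim ξ))) →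
      (∃ F : Set (EuclideanSpace ℝ (Fin n)), Bornology.IsBounded F ∧ ∀ k, dsupport (f k) ⊆ F) →
      ∃ f₀ : TestD n →L[ℂ] ℂ, ⇑f₀ = f_lim ∧
        ∃ (hf : ∀ k, IsConvolutionMultiplier (f k)) (hf₀ : IsConvolutionMultiplier f₀),
          ∀ γ ∈ CZero, ∀ U ∈ 𝓝 (0 : TestD n), ∀ g ∈ demiSpan γ U,
            ∀ B : Set (TestD n), IsVonNBounded ℂ B →
              TendstoUniformlyOn (fun k => (hf k).convFunctional g) (hf₀.convFunctional g)
                atTop B) ∧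
    -- the case `E = 𝓢`
    (∀ (f : ℕ → TestS n →L[ℂ] ℂ) (f_lim : TestS n → ℂ),
      (∀ ξ : TestS n, Tendsto (fun k => f k ξ) atTop (𝓝 (f_lim ξ))) →
      (∃ F : Set (EuclideanSpace ℝ (Fin n)), Bornology.IsBounded F ∧ ∀ k, dsupport (f k) ⊆ F) →
      ∃ f₀ : TestS n →L[ℂ] ℂ, ⇑f₀ = f_lim ∧
        ∃ (hf : ∀ k, IsConvolutionMultiplier (f k)) (hf₀ : IsConvolutionMultiplier f₀),
          ∀ γ ∈ CZero, ∀ U ∈ 𝓝 (0 : TestS n), ∀ g ∈ demiSpan γ U,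
            ∀ B : Set (TestS n), IsVonNBounded ℂ B →
              TendstoUniformlyOn (fun k => (hf k).convFunctional g) (hf₀.convFunctional g)
                atTop B) :=
  ⟨TestFunction.exists_tendstoUniformlyOn_convFunctional n,
    SchwartzMap.exists_tendstoUniformlyOn_convFunctional n⟩
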